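/- All graphs are finite, simple and undirected. For graphs $H$ and $G$ let $\hom(H,G)$ denote the number of homomorphisms from $H$ to $G$, i.e. of maps $V(H)\to V(G)$ under which the images of adjacent vertices are adjacent. Let $P_n$ be the path on $n$ vertices, and for positive integers $a,b,c$ let $Y_{a,b,c}$ be the tree on $a+b+c+1$ vertices with exactly three leaves in which the vertex of degree $3$ has distances $a$, $b$, $c$ from the leaves, respectively. Theorem. Let $T_n$ be a tree on $n$ vertices. Assume that there is a tree $T_m$ (on any number $m$ of vertices) such that $$\hom(T_m,T_n)<\hom(T_m,P_n).$$ Then $T_n$ is isomorphic to $Y_{1,1,n-3}$ and $n$ is even (in particular $n\ge 4$). -/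

import Mathlib

/-- The number `hom(H, G)` of homomorphisms from the graph `H` to the graph `G`. -/
noncomputable def homCount {V W : Type*} (H : SimpleGraph V) (G : SimpleGraph W) : ℕ :=
  Nat.card (H →g G)

/-- The tree `Y_{a,b,c}` on `a + b + c + 1` vertices: a centre `none` from which three legs
start, leg number `i` being a path with `a`, `b`, `c` vertices for `i = 0, 1, 2`.
The vertex `some ⟨i, j⟩` is the vertex of leg `i` at distance `j + 1` from the centre. -/
def starlikeY (a b c : ℕ) : SimpleGraph (Option (Σ i : Fin 3, Fin (![a, b, c] i))) :=
  SimpleGraph.fromRel fun x y =>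
    match x, y with
    | none, some ⟨_, j⟩ => j.val = 0
    | some ⟨i, j⟩, some ⟨i', j'⟩ => i = i' ∧ j'.val = j.val + 1
    | _, none => False

open SimpleGraph (pathGraph pathGraph_adj)

/-! ### Comparing homomorphism numbers -/

section Comparison

variable {V W W' : Type*}

/-! Let `T` be the source tree and `k` its number of edges. Lengthening a path by one vertex gains
at most `2 ^ k` homomorphisms, since one that uses the new end is determined by the direction of
each edge. Hence `hom(T, P_n) ≤ (n - 2) * 2 ^ k + 2` for `n ≥ 2`. Lower bounds for other targets
have two sources.

The first is entropy (`entropy_le_log_homCount`). A reversible Markov chain on `G`, started in its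
stationary distribution and run along the edges of `T`, is a random homomorphism, and its entropy is
at most `log hom(T, G)`. For the simple random walk this entropy depends on the sum of `d log d`
over the degrees. It already beats the path if some degree is at least four or if there are three
branch vertices (`homCount_path_le_of_branching`). What remains are paths, tripods and double forks.

The second is reflection (`homCount_le_of_reflect`). Removing the fibre over a cut vertex splits the
source into components, and those touching a chosen part of the target are reflected. Thus, under
mild conditions, moving a branch by an even distance `2 * t` along a path does not decrease the
count. The path is carried in this way to every tripod with a leg of positive even length. An odd
tripod with two legs of length at least three reduces to the case where the third leg is `1`, and
this is compared with `tripod 3 3 1`, whose spectral radius is `2`. The exceptions left have three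
odd legs, two of them equal to `1`, so their number of vertices is even.

In a double fork, shifts make all legs at most `2`. Then either one end carries two legs of length
`1` and an explicit walk of entropy rate `log 2` suffices, or both ends have a leg of length `2` and
one more shift leads back to a tripod with an even leg. The explicit walk needs at least six source
vertices; smaller sources are covered by the simple random walk. -/

theorem homCount_le_of_injective [Finite V] [Finite W'] (H : SimpleGraph V) {G : SimpleGraph W}
    {G' : SimpleGraph W'} (f : G →g G') (hf : Function.Injective f) :
    homCount H G ≤ homCount H G' := by
  refine Nat.card_le_card_of_injective (fun φ : H →g G => f.comp φ) fun φ ψ h => ?_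
  ext t
  exact hf (DFunLike.congr_fun h t)

theorem homCount_congr {V' : Type*} {H : SimpleGraph V} {H' : SimpleGraph V'} {G : SimpleGraph W}
    {G' : SimpleGraph W'} (e : H ≃g H') (f : G ≃g G') : homCount H G = homCount H' G' :=
  Nat.card_congr
    { toFun := fun φ => (f.toHom.comp φ).comp e.symm.toHom
      invFun := fun φ => (f.symm.toHom.comp φ).comp e.toHom
      left_inv := fun φ => by ext t; simp
      right_inv := fun φ => by ext t; simp }

/-- Two vertices of `H` are linked when they are adjacent and neither of them is sent to `c`. -/
def avoidStep (H : SimpleGraph V) (φ : V → W) (c : W) (x y : V) : Prop :=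
  H.Adj x y ∧ φ x ≠ c ∧ φ y ≠ c

/-- The component of `t` in `H` minus the fibre over `c` meets the fibre over `B`. -/
def Touches (H : SimpleGraph V) (φ : V → W) (c : W) (B : Set W) (t : V) : Prop :=
  ∃ s, Relation.ReflTransGen (avoidStep H φ c) t s ∧ φ s ∈ B

theorem avoidStep_symm {H : SimpleGraph V} {φ : V → W} {c : W} {x y : V}
    (h : avoidStep H φ c x y) : avoidStep H φ c y x :=
  ⟨h.1.symm, h.2.2, h.2.1⟩

theorem Touches.of_step {H : SimpleGraph V} {φ : V → W} {c : W} {B : Set W} {t s : V}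
    (h : avoidStep H φ c t s) (hs : Touches H φ c B s) : Touches H φ c B t :=
  let ⟨r, hr, hB⟩ := hs
  ⟨r, Relation.ReflTransGen.head h hr, hB⟩

theorem Touches.of_mem {H : SimpleGraph V} {φ : V → W} {c : W} {B : Set W} {t : V}
    (h : φ t ∈ B) : Touches H φ c B t :=
  ⟨t, Relation.ReflTransGen.refl, h⟩

theorem Touches.mem_side {H : SimpleGraph V} {G : SimpleGraph W} (φ : H →g G) {c : W}
    {R B : Set W} (hBR : B ⊆ R) (hR : ∀ u ∈ R, ∀ v, G.Adj u v → v ∈ R ∨ v = c) {t : V}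
    (h : Touches H φ c B t) : φ t ∈ R := by
  obtain ⟨s, hs, hB⟩ := h
  induction hs using Relation.ReflTransGen.head_induction_on with
  | refl => exact hBR hB
  | head hst _ ih => exact (hR _ ih _ (φ.map_rel hst.1.symm)).resolve_right hst.2.1

open Classical in
/-- Reflect by `ρ` the components touching `B`, and send everything else along `κ`. -/
noncomputable def flipMap (H : SimpleGraph V) (φ : V → W) (c : W) (B : Set W) (κ ρ : W → W')
    (t : V) : W' :=
  if φ t ≠ c ∧ Touches H φ c B t then ρ (φ t) else κ (φ t)

/-- If `G'` arises from `G` by moving the part `B` from one side `R` of the cut vertex `c` to its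
mirror image, then `G'` receives at least as many homomorphisms as `G`. -/
theorem homCount_le_of_reflect [Finite V] [Finite W'] (H : SimpleGraph V) {G : SimpleGraph W}
    {G' : SimpleGraph W'} (c : W) (R B : Set W) (κ ρ : W → W') (hBR : B ⊆ R) (hcR : c ∉ R)
    (hR : ∀ u ∈ R, ∀ v, G.Adj u v → v ∈ R ∨ v = c)
    (hκ : ∀ u v, u ∉ B → v ∉ B → G.Adj u v → G'.Adj (κ u) (κ v))
    (hρ : ∀ u ∈ R, ∀ v ∈ R, G.Adj u v → G'.Adj (ρ u) (ρ v))
    (hρc : ∀ u ∈ R, G.Adj u c → G'.Adj (ρ u) (κ c))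
    (hκi : ∀ u v, u ∉ B → v ∉ B → κ u = κ v → u = v)
    (hρi : ∀ u ∈ R, ∀ v ∈ R, ρ u = ρ v → u = v)
    (hρn : ∀ u ∈ R, ρ u ≠ κ c) (hκρ : ∀ u v, u ∉ B → v ∈ B → κ u ≠ ρ v) :
    homCount H G ≤ homCount H G' := by
  classical
  have hcB : c ∉ B := fun h => hcR (hBR h)
  have flip_c : ∀ (φ : H →g G) t, φ t = c → flipMap H φ c B κ ρ t = κ c := by
    intro φ t h
    simp [flipMap, h]
  have flip_touch : ∀ (φ : H →g G) t, φ t ≠ c → Touches H φ c B t →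
      flipMap H φ c B κ ρ t = ρ (φ t) := by
    intro φ t h h'
    simp [flipMap, h, h']
  have flip_not : ∀ (φ : H →g G) t, ¬ Touches H φ c B t →
      flipMap H φ c B κ ρ t = κ (φ t) := by
    intro φ t h
    simp [flipMap, h]
  have adj_c : ∀ (φ : H →g G) t t', H.Adj t t' → φ t ≠ c → φ t' = c →
      G'.Adj (flipMap H φ c B κ ρ t) (κ c) := by
    intro φ t t' h ht ht'
    have hadj : G.Adj (φ t) c := ht' ▸ φ.map_rel h
    by_cases hT : Touches H φ c B t
    · rw [flip_touch φ t ht hT]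
      exact hρc _ (hT.mem_side φ hBR hR) hadj
    · rw [flip_not φ t hT]
      exact hκ _ _ (fun hB => hT (.of_mem hB)) hcB hadj
  have hom : ∀ (φ : H →g G) {t t'}, H.Adj t t' →
      G'.Adj (flipMap H φ c B κ ρ t) (flipMap H φ c B κ ρ t') := by
    intro φ t t' h
    by_cases ht : φ t = c
    · have ht' : φ t' ≠ c := fun h' => (φ.map_rel h).ne (ht.trans h'.symm)
      rw [flip_c φ t ht]
      exact (adj_c φ t' t h.symm ht' ht).symm
    by_cases ht' : φ t' = c
    · rw [flip_c φ t' ht']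
      exact adj_c φ t t' h ht ht'
    have hs : avoidStep H φ c t t' := ⟨h, ht, ht'⟩
    by_cases hT : Touches H φ c B t
    · have hT' := hT.of_step (avoidStep_symm hs)
      rw [flip_touch φ t ht hT, flip_touch φ t' ht' hT']
      exact hρ _ (hT.mem_side φ hBR hR) _ (hT'.mem_side φ hBR hR) (φ.map_rel h)
    · have hT' : ¬ Touches H φ c B t' := fun h' => hT (h'.of_step hs)
      rw [flip_not φ t hT, flip_not φ t' hT']
      exact hκ _ _ (fun hB => hT (.of_mem hB)) (fun hB => hT' (.of_mem hB)) (φ.map_rel h)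
  -- Injectivity starts here: the image determines the fibre over `c`, hence also the components of
  -- its complement.
  have eq_c : ∀ (φ : H →g G) t, φ t = c ↔ flipMap H φ c B κ ρ t = κ c := by
    intro φ t
    refine ⟨flip_c φ t, fun h => ?_⟩
    by_contra ht
    by_cases hT : Touches H φ c B t
    · rw [flip_touch φ t ht hT] at h
      exact hρn _ (hT.mem_side φ hBR hR) h
    · rw [flip_not φ t hT] at h
      exact ht (hκi _ _ (fun hB => hT (.of_mem hB)) hcB h)
  -- Outside `B` the values of `κ` avoid `ρ '' B`, so the image shows which components were
  -- reflected.
  have touch_iff : ∀ (φ : H →g G) t, Touches H φ c B t ↔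
      ∃ s, Relation.ReflTransGen (avoidStep H φ c) t s ∧ flipMap H φ c B κ ρ s ∈ ρ '' B := by
    intro φ t
    constructor
    · rintro ⟨s, hs, hB⟩
      refine ⟨s, hs, φ s, hB, (flip_touch φ s ?_ (.of_mem hB)).symm⟩
      rintro h
      exact hcB (h ▸ hB)
    · rintro ⟨s, hs, b, hb, hbs⟩
      by_cases hT : Touches H φ c B s
      · obtain ⟨r, hr, hB⟩ := hT
        exact ⟨r, hs.trans hr, hB⟩
      · rw [flip_not φ s hT] at hbs
        exact (hκρ _ _ (fun hB => hT (.of_mem hB)) hb hbs.symm).elim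
  refine Nat.card_le_card_of_injective
    (fun φ : H →g G => (⟨flipMap H φ c B κ ρ, hom φ⟩ : H →g G')) fun φ ψ h => ?_
  have hfl : flipMap H φ c B κ ρ = flipMap H ψ c B κ ρ := congrArg DFunLike.coe h
  have hc : ∀ t, φ t = c ↔ ψ t = c := fun t => by rw [eq_c φ, eq_c ψ, hfl]
  have hstep : avoidStep H φ c = avoidStep H ψ c := by
    ext x y
    simp only [avoidStep, ne_eq, hc]
  have hT : ∀ t, Touches H φ c B t ↔ Touches H ψ c B t := fun t => by
    rw [touch_iff φ, touch_iff ψ, hfl, hstep]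
  ext t
  have ht := congrFun hfl t
  by_cases htc : φ t = c
  · rw [htc, (hc t).1 htc]
  have htc' : ψ t ≠ c := fun h' => htc ((hc t).2 h')
  by_cases hφ : Touches H φ c B t
  · have hψ := (hT t).1 hφ
    rw [flip_touch φ t htc hφ, flip_touch ψ t htc' hψ] at ht
    exact hρi _ (hφ.mem_side φ hBR hR) _ (hψ.mem_side ψ hBR hR) ht
  · have hψ : ¬ Touches H ψ c B t := fun h' => hφ ((hT t).2 h')
    rw [flip_not φ t hφ, flip_not ψ t hψ] at ht
    exact hκi _ _ (fun hB => hφ (.of_mem hB)) (fun hB => hψ (.of_mem hB)) ht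

end Comparison

/-! ### Trees given by a parent function -/

/-- `u` and `v` are joined by an edge from a vertex to its parent. -/
def ParentLink (p : ℕ → ℕ) (u v : ℕ) : Prop :=
  (u < v ∧ p v = u) ∨ (v < u ∧ p u = v)

theorem ParentLink.symm {p : ℕ → ℕ} {u v : ℕ} (h : ParentLink p u v) : ParentLink p v u :=
  Or.symm h

/-- The graph on `{0, …, n - 1}` in which every `i` is joined to `p i` as soon as `p i < i`. -/
def labelledTree (n : ℕ) (p : ℕ → ℕ) : SimpleGraph (Fin n) where
  Adj i j := ParentLink p i j
  symm := ⟨fun _ _ h => h.symm⟩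
  loopless := ⟨fun i h => by rcases h with h | h <;> exact lt_irrefl _ h.1⟩

theorem labelledTree_adj {n : ℕ} {p : ℕ → ℕ} {i j : Fin n} :
    (labelledTree n p).Adj i j ↔ ParentLink p i j := Iff.rfl

/-- Reduces a symmetric claim about edges to a claim about one label and its parent, which is plain
arithmetic. -/
theorem ParentLink.elim {n : ℕ} {p : ℕ → ℕ} {P : ℕ → ℕ → Prop}
    (hsymm : ∀ u v, P u v → P v u) (h : ∀ j < n, p j < j → P (p j) j) {u v : ℕ} (hu : u < n)
    (hv : v < n) (huv : ParentLink p u v) : P u v := by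
  rcases huv with ⟨h1, rfl⟩ | ⟨h1, rfl⟩
  · exact h _ hv h1
  · exact hsymm _ _ (h _ hu h1)

theorem labelledTree_congr {n : ℕ} {p q : ℕ → ℕ} (h : ∀ i < n, p i = q i) :
    labelledTree n p = labelledTree n q := by
  ext i j
  simp only [labelledTree_adj, ParentLink, h i i.2, h j j.2]

theorem labelledTree_pred (n : ℕ) : labelledTree n (fun i => i - 1) = SimpleGraph.pathGraph n := by
  ext i j
  rw [labelledTree_adj, SimpleGraph.pathGraph_adj]
  simp only [ParentLink]
  omega

section Maps

variable {V : Type*} [Finite V] (T : SimpleGraph V)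

theorem homCount_labelledTree_le {n n' : ℕ} {p p' : ℕ → ℕ} (f : ℕ → ℕ)
    (hf : ∀ i < n, f i < n') (hi : ∀ i < n, ∀ j < n, f i = f j → i = j)
    (hp : ∀ j < n, p j < j → ParentLink p' (f (p j)) (f j)) :
    homCount T (labelledTree n p) ≤ homCount T (labelledTree n' p') := by
  refine homCount_le_of_injective T
    ⟨fun i => ⟨f i, hf i i.2⟩, fun {i j} h => ?_⟩ fun i j h => ?_
  · exact ParentLink.elim (P := fun u v => ParentLink p' (f u) (f v)) (fun _ _ h => h.symm) hp
      i.2 j.2 h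
  · exact Fin.ext (hi _ i.2 _ j.2 (congrArg Fin.val h))

/-- Arithmetic form of `homCount_le_of_reflect`: each adjacency condition becomes a condition on a
label and its parent. -/
theorem homCount_labelledTree_le_of_reflect {n n' : ℕ} {p p' : ℕ → ℕ} (c : ℕ) (R B : ℕ → Prop)
    (κ ρ : ℕ → ℕ) (hc : c < n) (hBR : ∀ i, B i → R i) (hcR : ¬ R c)
    (hκn : ∀ i < n, κ i < n') (hρn : ∀ i < n, ρ i < n')
    (hR : ∀ j < n, p j < j → (R j → R (p j) ∨ p j = c) ∧ (R (p j) → R j ∨ j = c))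
    (hκ : ∀ j < n, p j < j → ¬ B (p j) → ¬ B j → ParentLink p' (κ (p j)) (κ j))
    (hρ : ∀ j < n, p j < j → R (p j) → R j → ParentLink p' (ρ (p j)) (ρ j))
    (hρc : ∀ j < n, p j < j → (R j → p j = c → ParentLink p' (ρ j) (κ c)) ∧
      (R (p j) → j = c → ParentLink p' (ρ (p j)) (κ c)))
    (hκi : ∀ i < n, ∀ j < n, ¬ B i → ¬ B j → κ i = κ j → i = j)
    (hρi : ∀ i < n, ∀ j < n, R i → R j → ρ i = ρ j → i = j)
    (hρk : ∀ i < n, R i → ρ i ≠ κ c) (hκρ : ∀ i < n, ∀ j < n, ¬ B i → B j → κ i ≠ ρ j) :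
    homCount T (labelledTree n p) ≤ homCount T (labelledTree n' p') := by
  refine homCount_le_of_reflect T (⟨c, hc⟩ : Fin n) {i | R i} {i | B i}
    (fun i => (⟨κ i, hκn i i.2⟩ : Fin n')) (fun i => (⟨ρ i, hρn i i.2⟩ : Fin n'))
    (fun i h => hBR _ h) hcR ?_ ?_ ?_ ?_ ?_ ?_ ?_ ?_
  · intro u hu v h
    have := ParentLink.elim
      (P := fun u v => (R u → R v ∨ v = c) ∧ (R v → R u ∨ u = c)) (fun _ _ h => ⟨h.2, h.1⟩)
      (fun j hj hp => ⟨(hR j hj hp).2, (hR j hj hp).1⟩) u.2 v.2 h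
    exact (this.1 hu).imp id Fin.ext
  · intro u v hu hv h
    exact ParentLink.elim (P := fun u v => ¬ B u → ¬ B v → ParentLink p' (κ u) (κ v))
      (fun _ _ h hu hv => (h hv hu).symm) hκ u.2 v.2 h hu hv
  · intro u hu v hv h
    exact ParentLink.elim (P := fun u v => R u → R v → ParentLink p' (ρ u) (ρ v))
      (fun _ _ h hu hv => (h hv hu).symm) hρ u.2 v.2 h hu hv
  · intro u hu h
    have := ParentLink.elim (P := fun u v => (R u → v = c → ParentLink p' (ρ u) (κ c)) ∧
      (R v → u = c → ParentLink p' (ρ v) (κ c))) (fun _ _ h => ⟨h.2, h.1⟩)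
      (fun j hj hp => ⟨(hρc j hj hp).2, (hρc j hj hp).1⟩) u.2 hc h
    exact this.1 hu rfl
  · intro u v hu hv h
    exact Fin.ext (hκi _ u.2 _ v.2 hu hv (congrArg Fin.val h))
  · intro u hu v hv h
    exact Fin.ext (hρi _ u.2 _ v.2 hu hv (congrArg Fin.val h))
  · intro u hu h
    exact hρk _ u.2 hu (congrArg Fin.val h)
  · intro u v hu hv h
    exact hκρ _ u.2 _ v.2 hu hv (congrArg Fin.val h)

end Maps

/-! ### Trees with three and four leaves -/

/-- Parent function of the tree with one branch vertex `a` and legs of lengths `a`, `b`, `c`. -/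
def tripodParent (a b : ℕ) (i : ℕ) : ℕ :=
  if i = a + b + 1 then a else i - 1

/-- The tree with legs of lengths `a`, `b`, `c` at a common vertex. -/
def tripod (a b c : ℕ) : SimpleGraph (Fin (a + b + c + 1)) :=
  labelledTree _ (tripodParent a b)

/-- Parent function of the tree with legs `a`, `b` at the vertex `a` and legs `c`, `d` at the
vertex `a + b + e`. -/
def doubleForkParent (a b e c : ℕ) (i : ℕ) : ℕ :=
  if i = a + b + 1 then a else if i = a + b + e + c + 1 then a + b + e else i - 1

/-- The tree with two branch vertices at distance `e`, the first of which carries legs of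
lengths `a`, `b` and the second legs of lengths `c`, `d`. -/
def doubleFork (a b e c d : ℕ) : SimpleGraph (Fin (a + b + e + c + d + 1)) :=
  labelledTree _ (doubleForkParent a b e c)

theorem tripodParent_spec (a b i : ℕ) :
    (i = a + b + 1 ∧ tripodParent a b i = a) ∨
      (i ≠ a + b + 1 ∧ tripodParent a b i = i - 1) := by
  unfold tripodParent
  split_ifs <;> omega

theorem doubleForkParent_spec (a b e c i : ℕ) :
    (i = a + b + 1 ∧ doubleForkParent a b e c i = a) ∨
      (i ≠ a + b + 1 ∧ i = a + b + e + c + 1 ∧ doubleForkParent a b e c i = a + b + e) ∨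
      (i ≠ a + b + 1 ∧ i ≠ a + b + e + c + 1 ∧ doubleForkParent a b e c i = i - 1) := by
  unfold doubleForkParent
  split_ifs <;> omega

/-! ### Moving a leg by an even distance -/

section Moves

variable {V : Type*} [Finite V] (T : SimpleGraph V)

/-- Regard the first and third legs as one long path and reflect it in its vertex `a + t`. The
attaching point `a + 2 * t` of the leg `b` goes to `a`. The part beyond it has length `c` and lands
on the first leg because `c ≤ a`. -/
theorem homCount_tripod_le_shift {a b c t : ℕ} (ht : 0 < t) (hca : c ≤ a) :
    homCount T (tripod (a + 2 * t) b c) ≤ homCount T (tripod a b (c + 2 * t)) := by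
  -- `κ` fixes the long path; the labels after `a` jump by `b` because the leg `b` is now inserted
  -- there.
  obtain ⟨κ, hκ⟩ : ∃ κ : ℕ → ℕ, ∀ y, (y ≤ a ∧ κ y = y) ∨
      (a < y ∧ y ≤ a + 2 * t ∧ κ y = y + b) ∨ (a + 2 * t < y ∧ κ y = y) :=
    ⟨fun y => if y ≤ a then y else if y ≤ a + 2 * t then y + b else y,
      fun y => by dsimp only; split_ifs <;> omega⟩
  -- `ρ` is the reflection, with label `y` of the third leg standing for position `y - b`; the value
  -- `0` for `y ≤ a + t` lies outside `R` and plays no role.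
  obtain ⟨ρ, hρ⟩ : ∃ ρ : ℕ → ℕ, ∀ y, (y ≤ a + t ∧ ρ y = 0) ∨
      (a + t < y ∧ y < a + 2 * t ∧ ρ y = 2 * (a + t) - y + b) ∨ (y = a + 2 * t ∧ ρ y = a) ∨
      (a + 2 * t < y ∧ y ≤ a + 2 * t + b ∧ ρ y = y - 2 * t) ∨
      (a + 2 * t + b < y ∧ ρ y = 2 * (a + t) - (y - b)) :=
    ⟨fun y => if y ≤ a + t then 0 else if y < a + 2 * t then 2 * (a + t) - y + b
      else if y = a + 2 * t then a else if y ≤ a + 2 * t + b then y - 2 * t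
      else 2 * (a + t) - (y - b), fun y => by dsimp only; split_ifs <;> omega⟩
  have hp := tripodParent_spec (a + 2 * t) b
  have hp' := tripodParent_spec a b
  refine homCount_labelledTree_le_of_reflect T (a + t) (fun y => a + t < y)
    (fun y => a + 2 * t < y ∧ y ≤ a + 2 * t + b) κ ρ
    (by omega) (by omega) (by omega) (fun i _ => ?_) (fun i _ => ?_) (fun j _ _ => ?_)
    (fun j _ _ _ _ => ?_) (fun j _ _ _ _ => ?_) (fun j _ _ => ⟨fun _ _ => ?_, fun _ _ => ?_⟩)
    (fun i _ j _ _ _ _ => ?_) (fun i _ j _ _ _ _ => ?_) (fun i _ _ => ?_)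
    (fun i _ j _ _ _ => ?_)
  · have := hκ i; omega
  · have := hρ i; omega
  · have := hp j; omega
  · obtain ⟨i, hi⟩ : ∃ i, tripodParent (a + 2 * t) b j = i := ⟨_, rfl⟩
    have hpj := hp j
    rw [hi] at *
    have hj := hκ j
    have hi' := hκ i
    have := hp' (κ j)
    unfold ParentLink
    rcases hj with hj | hj | hj <;> rcases hpj with hpj | hpj <;> omega
  · obtain ⟨i, hi⟩ : ∃ i, tripodParent (a + 2 * t) b j = i := ⟨_, rfl⟩
    have hpj := hp j
    rw [hi] at *
    have hj := hρ j
    have hi' := hρ i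
    have := hp' (ρ j)
    have := hp' (ρ i)
    unfold ParentLink
    rcases hpj with hpj | hpj <;> rcases hj with hj | hj | hj | hj | hj <;> omega
  · have hj : j = a + t + 1 := by have := hp j; omega
    have h1 : κ (a + t) = a + t + b := by have := hκ (a + t); omega
    have h2 : ρ j = a + t - 1 + b ∧ 1 < t ∨ ρ j = a ∧ t = 1 := by have := hρ j; omega
    have := hp' (a + t + b)
    rw [h1]
    unfold ParentLink; omega
  · have := hp j; omega
  · have := hκ i; have := hκ j; omega
  · have hi := hρ i
    have hj := hρ j
    rcases hi with hi | hi | hi | hi | hi <;> omega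
  · have := hρ i; have := hκ (a + t); omega
  · have := hκ i; have := hρ j; omega

set_option maxHeartbeats 1000000 in
-- The same reflection, now in the vertex at distance `t` before the second branch vertex, carries
-- the leg `c` back by `2 * t`. The tail `d` has at most two vertices, and since `a` and `e` are
-- positive there is room for its mirror image before the new branch vertex.
theorem homCount_doubleFork_le_shift {a b e c d t : ℕ} (ht : 0 < t) (ha : 0 < a) (he : 0 < e)
    (hd : d ≤ 2) :
    homCount T (doubleFork a b (e + 2 * t) c d) ≤
      homCount T (doubleFork a b e c (d + 2 * t)) := by
  obtain ⟨s, hs⟩ : ∃ s, s = a + b + e := ⟨_, rfl⟩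
  obtain ⟨κ, hκ⟩ : ∃ κ : ℕ → ℕ, ∀ y, (y ≤ s ∧ κ y = y) ∨
      (s < y ∧ y ≤ s + 2 * t ∧ κ y = y + c) ∨ (s + 2 * t < y ∧ κ y = y) :=
    ⟨fun y => if y ≤ s then y else if y ≤ s + 2 * t then y + c else y,
      fun y => by dsimp only; split_ifs <;> omega⟩
  -- `μ` skips the labels of the leg `b`: for `e = 1` the vertex before `s` on the long path is `a`,
  -- not `a + b`.
  obtain ⟨μ, hμ⟩ : ∃ μ : ℕ → ℕ, ∀ r, (a + b < r ∧ μ r = r) ∨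
      (r ≤ a + b ∧ μ r = r - b) :=
    ⟨fun r => if a + b < r then r else r - b, fun y => by dsimp only; split_ifs <;> omega⟩
  obtain ⟨ρ, hρ⟩ : ∃ ρ : ℕ → ℕ, ∀ y, (y ≤ s + t ∧ ρ y = 0) ∨
      (s + t < y ∧ y < s + 2 * t ∧ ρ y = 2 * (s + t) - y + c) ∨
      (y = s + 2 * t ∧ ρ y = s) ∨
      (s + 2 * t < y ∧ y ≤ s + 2 * t + c ∧ ρ y = y - 2 * t) ∨
      (s + 2 * t + c < y ∧ ρ y = μ (2 * (s + t) - (y - c))) :=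
    ⟨fun y => if y ≤ s + t then 0 else if y < s + 2 * t then 2 * (s + t) - y + c
      else if y = s + 2 * t then s else if y ≤ s + 2 * t + c then y - 2 * t
      else μ (2 * (s + t) - (y - c)), fun y => by dsimp only; split_ifs <;> omega⟩
  have hp := doubleForkParent_spec a b (e + 2 * t) c
  have hp' := doubleForkParent_spec a b e c
  refine homCount_labelledTree_le_of_reflect T (s + t) (fun y => s + t < y)
    (fun y => s + 2 * t < y ∧ y ≤ s + 2 * t + c) κ ρ
    (by omega) (by omega) (by omega) (fun i _ => ?_) (fun i _ => ?_) (fun j _ _ => ?_)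
    (fun j _ _ _ _ => ?_) (fun j _ _ _ _ => ?_) (fun j _ _ => ⟨fun _ _ => ?_, fun _ _ => ?_⟩)
    (fun i _ j _ _ _ _ => ?_) (fun i _ j _ _ _ _ => ?_) (fun i _ _ => ?_)
    (fun i _ j _ _ _ => ?_)
  · have := hκ i; omega
  · have := hρ i; have := hμ (2 * (s + t) - (i - c)); omega
  · have := hp j; omega
  · obtain ⟨i, hi⟩ : ∃ i, doubleForkParent a b (e + 2 * t) c j = i := ⟨_, rfl⟩
    have hpj := hp j
    rw [hi] at *
    have hj := hκ j
    have hi' := hκ i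
    have := hp' (κ j)
    unfold ParentLink
    rcases hj with hj | hj | hj <;> rcases hpj with hpj | hpj | hpj <;> omega
  · obtain ⟨i, hi⟩ : ∃ i, doubleForkParent a b (e + 2 * t) c j = i := ⟨_, rfl⟩
    have hpj := hp j
    rw [hi] at *
    -- As `d ≤ 2`, at most two labels follow the leg `c`, and only these involve `μ`.
    have hcases : (j ≤ s + 2 * t ∧ i + 1 = j) ∨ (s + 2 * t < j ∧ j ≤ s + 2 * t + c ∧ i + 1 = j) ∨
        (j = s + 2 * t + c + 1 ∧ i = s + 2 * t) ∨
        (j = s + 2 * t + c + 2 ∧ i = s + 2 * t + c + 1) := by omega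
    have hj := hρ j
    have hi' := hρ i
    rcases hcases with ⟨h1, h2⟩ | ⟨h1, h2, h3⟩ | ⟨rfl, rfl⟩ | ⟨rfl, rfl⟩
    · have e2 : ρ i = ρ j + 1 ∨ ρ i = s + c + 1 ∧ ρ j = s := by omega
      have := hp' (ρ i)
      unfold ParentLink; omega
    · have e2 : (ρ j = ρ i + 1 ∧ s + 1 < ρ j ∧ ρ j ≤ s + c) ∨ ρ j = s + 1 ∧ ρ i = s := by omega
      have := hp' (ρ j)
      unfold ParentLink; omega
    · have e1 : ρ (s + 2 * t) = s := by omega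
      have e2 : 2 * (s + t) - (s + 2 * t + c + 1 - c) = s - 1 := by omega
      rw [e2] at hj
      have e3 : ρ (s + 2 * t + c + 1) = μ (s - 1) := by omega
      have := hμ (s - 1)
      have := hp' s
      rw [e1, e3]
      unfold ParentLink; omega
    · have e1 : 2 * (s + t) - (s + 2 * t + c + 1 - c) = s - 1 := by omega
      have e2 : 2 * (s + t) - (s + 2 * t + c + 2 - c) = s - 2 := by omega
      rw [e1] at hi'
      rw [e2] at hj
      have e3 : ρ (s + 2 * t + c + 1) = μ (s - 1) := by clear hj; omega
      have e4 : ρ (s + 2 * t + c + 2) = μ (s - 2) := by clear hi'; omega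
      rw [e3, e4]
      clear hj hi' hpj e1 e2 e3 e4
      have h1 := hμ (s - 1)
      have := hμ (s - 2)
      have := hp' (μ (s - 1))
      unfold ParentLink
      rcases h1 with h1 | h1 <;> omega
  · have hj : j = s + t + 1 := by have := hp j; omega
    have h1 : κ (s + t) = s + t + c := by have := hκ (s + t); omega
    have h2 : ρ j = s + t - 1 + c ∧ 1 < t ∨ ρ j = s ∧ t = 1 := by have := hρ j; omega
    have := hp' (s + t + c)
    rw [h1]
    unfold ParentLink; omega
  · have := hp j; omega
  · have := hκ i; have := hκ j; omega
  · have hi := hρ i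
    have hj := hρ j
    have := hμ (2 * (s + t) - (i - c))
    have := hμ (2 * (s + t) - (j - c))
    rcases hi with hi | hi | hi | hi | hi <;> omega
  · have := hρ i; have := hκ (s + t); have := hμ (2 * (s + t) - (i - c)); omega
  · have := hκ i; have := hρ j; have := hμ (2 * (s + t) - (j - c)); omega

end Moves

/-! ### Labelling trees -/

/-- The number of neighbours of a vertex. -/
noncomputable def valency {W : Type*} (G : SimpleGraph W) (v : W) : ℕ :=
  (G.neighborSet v).ncard

theorem valency_eq_degree {W : Type*} [Fintype W] (G : SimpleGraph W) (v : W)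
    [Fintype (G.neighborSet v)] : valency G v = G.degree v := by
  rw [valency, Set.ncard_eq_toFinset_card', SimpleGraph.degree, SimpleGraph.neighborFinset]

theorem valency_iso {W W' : Type*} {G : SimpleGraph W} {G' : SimpleGraph W'} (e : G ≃g G')
    (v : W) : valency G' (e v) = valency G v := by
  have : G'.neighborSet (e v) = e '' G.neighborSet v := by
    ext w
    constructor
    · intro h
      refine ⟨e.symm w, ?_, e.apply_symm_apply w⟩
      have : G'.Adj (e v) (e (e.symm w)) := by simpa using h
      exact e.map_rel_iff.1 this
    · rintro ⟨u, hu, rfl⟩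
      exact e.map_rel_iff.2 hu
  rw [valency, valency, this, Set.ncard_image_of_injective _ e.injective]

theorem valency_induce_eq_ncard {W : Type*} (G : SimpleGraph W) {l : W} (u : W) (hu : u ≠ l) :
    valency (G.induce {l}ᶜ) ⟨u, hu⟩ = (G.neighborSet u \ {l}).ncard := by
  have himg : Subtype.val '' (G.induce {l}ᶜ).neighborSet ⟨u, hu⟩ = G.neighborSet u \ {l} := by
    ext w
    simp only [Set.mem_image, SimpleGraph.mem_neighborSet, SimpleGraph.comap_adj, Set.mem_sdiff,
      Set.mem_singleton_iff, Subtype.exists, exists_and_right, exists_eq_right,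
      Function.Embedding.subtype_apply]
    exact ⟨fun ⟨h1, h2⟩ => ⟨h2, h1⟩, fun ⟨h1, h2⟩ => ⟨h2, h1⟩⟩
  rw [← himg, Set.ncard_image_of_injective _ Subtype.val_injective, valency]

theorem valency_induce_of_ne {W : Type*} (G : SimpleGraph W) {l v : W}
    (hl : ∀ w, G.Adj l w ↔ w = v) (u : W) (hu : u ≠ l) (huv : u ≠ v) :
    valency (G.induce {l}ᶜ) ⟨u, hu⟩ = valency G u := by
  rw [valency_induce_eq_ncard, Set.sdiff_singleton_eq_self, valency]
  exact fun h => huv ((hl u).1 h.symm)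

theorem valency_induce_neighbor {W : Type*} [Finite W] (G : SimpleGraph W) {l v : W}
    (hl : ∀ w, G.Adj l w ↔ w = v) (hv : v ≠ l) :
    valency (G.induce {l}ᶜ) ⟨v, hv⟩ + 1 = valency G v := by
  have : l ∈ G.neighborSet v := ((hl v).2 rfl).symm
  rw [valency_induce_eq_ncard, Set.ncard_sdiff_singleton_add_one this, valency]

theorem valency_induce_le {W : Type*} [Finite W] (G : SimpleGraph W) {l : W} (u : W)
    (hu : u ≠ l) : valency (G.induce {l}ᶜ) ⟨u, hu⟩ ≤ valency G u := by
  rw [valency_induce_eq_ncard, valency]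
  exact Set.ncard_le_ncard Set.sdiff_subset

theorem valency_le_one_of_unique {W : Type*} {G : SimpleGraph W} {z w : W}
    (h : ∀ u, G.Adj z u → u = w) : valency G z ≤ 1 :=
  (Set.ncard_le_ncard (fun u hu => h u hu) (Set.finite_singleton w)).trans
    (Set.ncard_singleton w).le

theorem exists_isTree_leaf {W : Type*} [Finite W] [Nontrivial W] {G : SimpleGraph W}
    (hG : G.IsTree) : ∃ l, valency G l = 1 := by
  classical
  have := Fintype.ofFinite W
  obtain ⟨l, hl⟩ := hG.exists_vert_degree_one_of_nontrivial
  exact ⟨l, by rw [valency_eq_degree, hl]⟩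

/-- Removing a leaf `l` with neighbour `v` from a tree leaves a tree. -/
theorem exists_leaf_removal {W : Type*} [Fintype W] {G : SimpleGraph W} (hG : G.IsTree) {n : ℕ}
    (hn : Fintype.card W = n + 2) {l : W} (hl : valency G l ≤ 1) :
    ∃ v, v ≠ l ∧ (∀ w, G.Adj l w ↔ w = v) ∧ (G.induce {l}ᶜ).IsTree ∧
      Nat.card ({l}ᶜ : Set W) = n + 1 := by
  classical
  have : Nontrivial W := Fintype.one_lt_card_iff_nontrivial.1 (by omega)
  have hdeg : G.degree l = 1 := by
    have := hG.connected.preconnected.degree_pos_of_nontrivial l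
    rw [valency_eq_degree] at hl
    omega
  obtain ⟨v, hv, huniq⟩ := SimpleGraph.degree_eq_one_iff_existsUnique_adj.1 hdeg
  refine ⟨v, hv.ne.symm, fun w => ⟨huniq w, fun h => h ▸ hv⟩,
    ⟨hG.connected.induce_compl_singleton_of_degree_eq_one hdeg, hG.isAcyclic.induce _⟩, ?_⟩
  rw [Nat.card_eq_fintype_card, Fintype.card_compl_set, hn]
  simp

/-- Induction step of all recognition results: the removed leaf gets the new last label and the old
labels persist, so `q` only has to extend `p` by the label of `v`. -/
theorem exists_iso_of_leaf {W : Type*} {G : SimpleGraph W} {l v : W} (hvl : v ≠ l)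
    (hl : ∀ w, G.Adj l w ↔ w = v) {n : ℕ} {p q : ℕ → ℕ}
    (e : G.induce {l}ᶜ ≃g labelledTree n p) (hq : ∀ i < n, q i = p i)
    (hqn : q n = e ⟨v, hvl⟩) :
    ∃ e' : G ≃g labelledTree (n + 1) q,
      (e' l : ℕ) = n ∧ ∀ u (hu : u ≠ l), (e' u : ℕ) = e ⟨u, hu⟩ := by
  classical
  let f : W → Fin (n + 1) := fun w => if h : w = l then Fin.last n else (e ⟨w, h⟩).castSucc
  have fl : f l = Fin.last n := by simp [f]
  have fn : ∀ u (hu : u ≠ l), f u = (e ⟨u, hu⟩).castSucc := fun u hu => by simp [f, hu]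
  have hinj : Function.Injective f := by
    intro x y h
    by_cases hx : x = l <;> by_cases hy : y = l
    · rw [hx, hy]
    · rw [hx, fl, fn y hy] at h
      exact absurd h.symm (Fin.castSucc_lt_last _).ne
    · rw [hy, fl, fn x hx] at h
      exact absurd h (Fin.castSucc_lt_last _).ne
    · rw [fn x hx, fn y hy] at h
      exact congrArg Subtype.val (e.injective (Fin.castSucc_injective _ h))
  have hsurj : Function.Surjective f := by
    intro i
    induction i using Fin.lastCases with
    | last => exact ⟨l, fl⟩
    | cast i =>
      refine ⟨(e.symm i).1, ?_⟩
      rw [fn _ (e.symm i).2]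
      exact congrArg Fin.castSucc (e.apply_symm_apply i)
  have hadj_l : ∀ w (hw : w ≠ l), ParentLink q n (e ⟨w, hw⟩) ↔
      G.Adj l w := by
    intro w hw
    rw [hl, ParentLink, hqn]
    have h1 := (e ⟨w, hw⟩).2
    constructor
    · rintro (h | h)
      · omega
      · have := e.injective (Fin.ext h.2)
        exact (congrArg Subtype.val this).symm
    · rintro rfl
      exact Or.inr ⟨h1, rfl⟩
  refine ⟨⟨Equiv.ofBijective f ⟨hinj, hsurj⟩, fun {x y} => ?_⟩, ?_, fun u hu => ?_⟩
  · change ParentLink _ (f x : ℕ) (f y : ℕ) ↔ _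
    by_cases hx : x = l <;> by_cases hy : y = l
    · rw [hx, hy]
      simp [ParentLink]
    · rw [hx, fl, fn y hy]
      exact hadj_l y hy
    · rw [hy, fl, fn x hx, G.adj_comm]
      exact Iff.trans ⟨fun h => h.symm, fun h => h.symm⟩ (hadj_l x hx)
    · rw [fn x hx, fn y hy]
      have h1 := (e ⟨x, hx⟩).2
      have h2 := (e ⟨y, hy⟩).2
      rw [ParentLink, Fin.val_castSucc, Fin.val_castSucc, hq _ h1, hq _ h2]
      exact e.map_rel_iff (a := ⟨x, hx⟩) (b := ⟨y, hy⟩)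
  · exact congrArg Fin.val fl
  · exact congrArg Fin.val (fn u hu)

theorem exists_iso_labelledTree {n : ℕ} : ∀ {W : Type*} [Fintype W] {G : SimpleGraph W},
    G.IsTree → Fintype.card W = n + 1 →
    ∃ p : ℕ → ℕ, (∀ i, 0 < i → i < n + 1 → p i < i) ∧ Nonempty (G ≃g labelledTree (n + 1) p) := by
  induction n with
  | zero =>
    intro W _ G hG hn
    have := Fintype.card_le_one_iff_subsingleton.1 hn.le
    refine ⟨fun _ => 0, fun i h1 h2 => by omega, ⟨⟨Fintype.equivFinOfCardEq hn, fun {a b} => ?_⟩⟩⟩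
    rw [Subsingleton.elim a b]
    simp
  | succ n ih =>
    intro W _ G hG hn
    classical
    have : Nontrivial W := Fintype.one_lt_card_iff_nontrivial.1 (by omega)
    obtain ⟨l, hl⟩ := exists_isTree_leaf hG
    obtain ⟨v, hvl, hadj, hG', hcard⟩ := exists_leaf_removal hG hn hl.le
    obtain ⟨p, hp, ⟨e⟩⟩ := ih hG' (by rw [← Nat.card_eq_fintype_card]; exact hcard)
    obtain ⟨e', -⟩ := exists_iso_of_leaf (q := Function.update p (n + 1) (e ⟨v, hvl⟩)) hvl hadj e
      (fun i hi => Function.update_of_ne hi.ne _ _) (Function.update_self _ _ _)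
    refine ⟨_, fun i h1 h2 => ?_, ⟨e'⟩⟩
    rcases eq_or_ne i (n + 1) with rfl | h
    · rw [Function.update_self]
      exact (e _).2
    · rw [Function.update_of_ne h]
      exact hp i h1 (by omega)

/-! ### Recognising paths, tripods and double forks -/

/-- An isomorphism of labelled trees given by mutually inverse maps of labels. -/
def labelledTreeIso {n : ℕ} {p p' : ℕ → ℕ} (f g : ℕ → ℕ) (hf : ∀ i < n, f i < n)
    (hg : ∀ i < n, g i < n) (hgf : ∀ i < n, g (f i) = i) (hfg : ∀ i < n, f (g i) = i)
    (h : ∀ j < n, p j < j → ParentLink p' (f (p j)) (f j))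
    (h' : ∀ j < n, p' j < j → ParentLink p (g (p' j)) (g j)) :
    labelledTree n p ≃g labelledTree n p' where
  toFun i := ⟨f i, hf i i.2⟩
  invFun i := ⟨g i, hg i i.2⟩
  left_inv i := Fin.ext (hgf i i.2)
  right_inv i := Fin.ext (hfg i i.2)
  map_rel_iff' {i j} := by
    constructor
    · intro hij
      have := ParentLink.elim (P := fun u v => ParentLink p (g u) (g v)) (fun _ _ h => h.symm) h'
        (hf i i.2) (hf j j.2) hij
      rwa [hgf i i.2, hgf j j.2] at this
    · intro hij
      exact ParentLink.elim (P := fun u v => ParentLink p' (f u) (f v)) (fun _ _ h => h.symm) h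
        i.2 j.2 hij

theorem exists_iso_tripod_swap_left (a b c : ℕ) {n : ℕ} (hn : n = a + b + c + 1) :
    ∃ e : labelledTree n (tripodParent a b) ≃g labelledTree n (tripodParent b a),
      ∀ i : Fin n, ((i : ℕ) ≤ a + b ∧ (e i : ℕ) = a + b - i) ∨ (a + b < i ∧ (e i : ℕ) = i) := by
  obtain ⟨f, hf⟩ : ∃ f : ℕ → ℕ, ∀ y, (y ≤ a + b ∧ f y = a + b - y) ∨ (a + b < y ∧ f y = y) :=
    ⟨fun y => if y ≤ a + b then a + b - y else y, fun y => by dsimp only; split_ifs <;> omega⟩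
  have hp := tripodParent_spec a b
  have hp' := tripodParent_spec b a
  refine ⟨labelledTreeIso f f (fun i _ => ?_) (fun i _ => ?_) (fun i _ => ?_) (fun i _ => ?_)
    (fun j _ _ => ?_) (fun j _ _ => ?_), fun i => hf i⟩
  · have := hf i; omega
  · have := hf i; omega
  · have := hf i; have := hf (f i); omega
  · have := hf i; have := hf (f i); omega
  · have := hp j; have := hf j; have := hf (tripodParent a b j)
    have := hp' (f j); have := hp' (f (tripodParent a b j))
    unfold ParentLink; omega
  · have := hp' j; have := hf j; have := hf (tripodParent b a j)
    have := hp (f j); have := hp (f (tripodParent b a j))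
    unfold ParentLink; omega

theorem exists_iso_tripod_swap_right (a b c : ℕ) {n : ℕ} (hn : n = a + b + c + 1) :
    ∃ e : labelledTree n (tripodParent a b) ≃g labelledTree n (tripodParent a c),
      ∀ i : Fin n, ((i : ℕ) ≤ a ∧ (e i : ℕ) = i) ∨ (a < i ∧ i ≤ a + b ∧ (e i : ℕ) = i + c) ∨
        (a + b < i ∧ (e i : ℕ) = i - b) := by
  have key : ∀ b c : ℕ, ∃ f : ℕ → ℕ, ∀ y, (y ≤ a ∧ f y = y) ∨
      (a < y ∧ y ≤ a + b ∧ f y = y + c) ∨ (a + b < y ∧ f y = y - b) := fun b c =>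
    ⟨fun y => if y ≤ a then y else if y ≤ a + b then y + c else y - b,
      fun y => by dsimp only; split_ifs <;> omega⟩
  obtain ⟨f, hf⟩ := key b c
  obtain ⟨g, hg⟩ := key c b
  have hp := tripodParent_spec a b
  have hp' := tripodParent_spec a c
  refine ⟨labelledTreeIso f g (fun i _ => ?_) (fun i _ => ?_) (fun i _ => ?_) (fun i _ => ?_)
    (fun j _ _ => ?_) (fun j _ _ => ?_), fun i => hf i⟩
  · have := hf i; omega
  · have := hg i; omega
  · have := hf i; have := hg (f i); omega
  · have := hg i; have := hf (g i); omega
  · have := hp j; have := hf j; have := hf (tripodParent a b j)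
    have := hp' (f j); have := hp' (f (tripodParent a b j))
    unfold ParentLink; omega
  · have := hp' j; have := hg j; have := hg (tripodParent a c j)
    have := hp (g j); have := hp (g (tripodParent a c j))
    unfold ParentLink; omega

theorem valency_labelledTree_le_one {n : ℕ} {p : ℕ → ℕ} (z : Fin n) (w : ℕ)
    (h : ∀ u < n, ParentLink p z u → u = w) : valency (labelledTree n p) z ≤ 1 := by
  by_cases hw : w < n
  · exact valency_le_one_of_unique (w := ⟨w, hw⟩) fun u hu => Fin.ext (h u u.2 hu)
  · exact valency_le_one_of_unique (w := z) fun u hu => absurd (h u u.2 hu ▸ u.2) hw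

/-- Prescribing which leaf gets the last label makes the induction work: the neighbour of `l` is
prescribed in the smaller path, and `l` continues it. -/
theorem exists_iso_path {n : ℕ} : ∀ {W : Type*} [Fintype W] {G : SimpleGraph W},
    G.IsTree → Fintype.card W = n + 1 → (∀ u, valency G u ≤ 2) → ∀ l, valency G l ≤ 1 →
    ∃ e : G ≃g labelledTree (n + 1) (fun i => i - 1), (e l : ℕ) = n := by
  induction n with
  | zero =>
    intro W _ G hG hn _ l _
    have := Fintype.card_le_one_iff_subsingleton.1 hn.le
    refine ⟨⟨Fintype.equivFinOfCardEq hn, fun {a b} => ?_⟩, by omega⟩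
    rw [Subsingleton.elim a b]
    simp
  | succ n ih =>
    intro W _ G hG hn hdeg l hl
    classical
    obtain ⟨v, hvl, hadj, hG', hcard⟩ := exists_leaf_removal hG hn hl
    have hv := valency_induce_neighbor G hadj hvl
    obtain ⟨e, he⟩ := ih hG' (by rw [← Nat.card_eq_fintype_card]; exact hcard)
      (fun u => (valency_induce_le G u.1 u.2).trans (hdeg u)) ⟨v, hvl⟩
      (by have := hdeg v; omega)
    obtain ⟨e', he', -⟩ := exists_iso_of_leaf hvl hadj e (fun i _ => rfl) he.symm
    exact ⟨e', he'⟩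

theorem two_lt_valency_center {a b c n : ℕ} (hn : n = a + b + c + 1) (ha : 0 < a) (hb : 0 < b)
    (hc : 0 < c) (z : Fin n) (hz : (z : ℕ) = a) :
    2 < valency (labelledTree n (tripodParent a b)) z := by
  have hp := tripodParent_spec a b
  have hadj : ∀ (i : ℕ) (hi : i < n), (i = a - 1 ∨ i = a + 1 ∨ i = a + b + 1) →
      (⟨i, hi⟩ : Fin n) ∈ (labelledTree n (tripodParent a b)).neighborSet z := by
    intro i hi h
    have h1 := hp i
    have h2 := hp a
    change ParentLink _ (z : ℕ) i
    rw [hz]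
    unfold ParentLink
    omega
  rw [valency, Set.two_lt_ncard_iff]
  refine ⟨⟨a - 1, by omega⟩, ⟨a + 1, by omega⟩, ⟨a + b + 1, by omega⟩, hadj _ _ (by simp),
    hadj _ _ (by simp), hadj _ _ (by simp), ?_, ?_, ?_⟩ <;>
    simp only [ne_eq, Fin.mk.injEq] <;> omega

/-- A vertex of degree two of a tripod can be moved to the interior of the third leg. -/
theorem exists_iso_tripod_last_leg {a b c n : ℕ} (hn : n = a + b + c + 1) (ha : 0 < a)
    (hb : 0 < b) (hc : 0 < c) (z : Fin n)
    (hz : valency (labelledTree n (tripodParent a b)) z = 2) :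
    ∃ a' b' c', n = a' + b' + c' + 1 ∧ 0 < a' ∧ 0 < b' ∧ 0 < c' ∧
      ∃ e : labelledTree n (tripodParent a b) ≃g labelledTree n (tripodParent a' b'),
        a' + b' < e z ∧ (e z : ℕ) + 1 < n := by
  have hp := tripodParent_spec a b
  have hleaf : ∀ w : ℕ, ¬ ∀ u < n, ParentLink (tripodParent a b) z u → u = w := fun w h => by
    have := valency_labelledTree_le_one z w h
    omega
  have h0 : (z : ℕ) ≠ 0 := fun h => hleaf 1 fun u _ hu => by
    have := hp u; unfold ParentLink at hu; omega
  have h1 : (z : ℕ) ≠ a + b := fun h => hleaf (a + b - 1) fun u _ hu => by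
    have := hp u; have := hp z; unfold ParentLink at hu; omega
  have h2 : (z : ℕ) + 1 ≠ n := fun h => hleaf (tripodParent a b z) fun u _ hu => by
    unfold ParentLink at hu; omega
  have h3 : (z : ℕ) ≠ a := fun h => by
    have := two_lt_valency_center hn ha hb hc z h
    omega
  have hzn := z.2
  rcases lt_trichotomy (z : ℕ) a with h | h | h
  · obtain ⟨e, he⟩ := exists_iso_tripod_swap_left a b c hn
    obtain ⟨f, hf⟩ := exists_iso_tripod_swap_right b a c (n := n) (by omega)
    refine ⟨b, c, a, by omega, hb, hc, ha, e.trans f, ?_⟩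
    have := he z
    have := hf (e z)
    change b + c < (f (e z) : ℕ) ∧ (f (e z) : ℕ) + 1 < n
    omega
  · exact absurd h h3
  · rcases le_or_gt (z : ℕ) (a + b) with h' | h'
    · obtain ⟨f, hf⟩ := exists_iso_tripod_swap_right a b c hn
      refine ⟨a, c, b, by omega, ha, hc, hb, f, ?_⟩
      have := hf z
      omega
    · exact ⟨a, b, c, hn, ha, hb, hc, SimpleGraph.Iso.refl, h', by
        change (z : ℕ) + 1 < n; omega⟩

/-- If the removed leaf hangs at the branch vertex, a path remains and the leaf is a third leg of
length one. Otherwise its neighbour is a leaf of a smaller tripod, and the third leg grows by one.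
-/
theorem exists_iso_tripod {n : ℕ} : ∀ {W : Type*} [Fintype W] {G : SimpleGraph W},
    G.IsTree → Fintype.card W = n + 1 → ∀ x, valency G x = 3 → (∀ u, u ≠ x → valency G u ≤ 2) →
    ∀ l, valency G l ≤ 1 → ∃ a b c, 0 < a ∧ 0 < b ∧ 0 < c ∧ n = a + b + c ∧
      ∃ e : G ≃g labelledTree (n + 1) (tripodParent a b), (e l : ℕ) = n := by
  induction n with
  | zero =>
    intro W _ G hG hn x hx _ l _
    exfalso
    have := Fintype.card_le_one_iff_subsingleton.1 hn.le
    have := valency_le_one_of_unique (G := G) (z := x) (w := x) fun u _ => Subsingleton.elim _ _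
    omega
  | succ n ih =>
    intro W _ G hG hn x hx hdeg l hl
    classical
    obtain ⟨v, hvl, hadj, hG', hcard⟩ := exists_leaf_removal hG hn hl
    have hcard' : Fintype.card ({l}ᶜ : Set W) = n + 1 := by
      rw [← Nat.card_eq_fintype_card]; exact hcard
    have hv := valency_induce_neighbor G hadj hvl
    have hle := fun u : ({l}ᶜ : Set W) => valency_induce_le G u.1 u.2
    by_cases hvx : v = x
    · subst hvx
      have hv2 : valency (G.induce {l}ᶜ) ⟨v, hvl⟩ = 2 := by omega
      have hdeg' : ∀ u, valency (G.induce {l}ᶜ) u ≤ 2 := fun u => by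
        by_cases h : u = ⟨v, hvl⟩
        · rw [h, hv2]
        · exact (hle u).trans (hdeg u fun h' => h (Subtype.ext h'))
      have : Nontrivial ({l}ᶜ : Set W) := by
        by_contra h
        rw [not_nontrivial_iff_subsingleton] at h
        have := valency_le_one_of_unique (G := G.induce {l}ᶜ) (z := ⟨v, hvl⟩) (w := ⟨v, hvl⟩)
          fun u _ => Subsingleton.elim _ _
        omega
      obtain ⟨l', hl'⟩ := exists_isTree_leaf hG'
      obtain ⟨e, -⟩ := exists_iso_path hG' hcard' hdeg' l' hl'.le
      obtain ⟨s, hs⟩ : ∃ s : ℕ, s = e ⟨v, hvl⟩ := ⟨_, rfl⟩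
      have hsv := valency_iso e ⟨v, hvl⟩
      rw [hv2] at hsv
      have hsn : s < n + 1 := hs ▸ (e ⟨v, hvl⟩).2
      have hs0 : s ≠ 0 := fun h => by
        have := valency_labelledTree_le_one (p := fun i => i - 1) (e ⟨v, hvl⟩) 1 fun u _ hu => by
          simp only [ParentLink] at hu; omega
        omega
      have hsn' : s ≠ n := fun h => by
        have := valency_labelledTree_le_one (p := fun i => i - 1) (e ⟨v, hvl⟩) (n - 1)
          fun u _ hu => by simp only [ParentLink] at hu; omega
        omega
      have hp := tripodParent_spec s (n - s)
      obtain ⟨e', he', -⟩ := exists_iso_of_leaf (q := tripodParent s (n - s)) hvl hadj e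
        (fun i hi => by have := hp i; omega) (by have := hp (n + 1); omega)
      exact ⟨s, n - s, 1, by omega, by omega, by omega, by omega, e', he'⟩
    · have hxl : x ≠ l := fun h => by rw [h] at hx; omega
      have hx' := valency_induce_of_ne G hadj x hxl (Ne.symm hvx)
      obtain ⟨a, b, c, ha, hb, hc, hnab, e, he⟩ := ih hG' hcard' ⟨x, hxl⟩ (by omega)
        (fun u hu => (hle u).trans (hdeg u fun h => hu (Subtype.ext h))) ⟨v, hvl⟩
        (by have := hdeg v hvx; omega)
      have hp := tripodParent_spec a b
      obtain ⟨e', he', -⟩ := exists_iso_of_leaf (q := tripodParent a b) hvl hadj e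
        (fun i _ => rfl) (by have := hp (n + 1); omega)
      exact ⟨a, b, c + 1, ha, hb, by omega, by omega, e', he'⟩

/-- If the removed leaf hangs at a branch vertex, that vertex has degree two in the remaining
tripod. It can be relabelled into the interior of the third leg, which splits into the connecting
path and a leg; the leaf is the fourth leg. Otherwise the fourth leg grows by one. -/
theorem exists_iso_doubleFork {n : ℕ} : ∀ {W : Type*} [Fintype W] {G : SimpleGraph W},
    G.IsTree → Fintype.card W = n + 1 → ∀ x y, x ≠ y → valency G x = 3 → valency G y = 3 →
    (∀ u, u ≠ x → u ≠ y → valency G u ≤ 2) → ∀ l, valency G l ≤ 1 →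
    ∃ a b e c d, 0 < a ∧ 0 < b ∧ 0 < e ∧ 0 < c ∧ 0 < d ∧ n = a + b + e + c + d ∧
      ∃ f : G ≃g labelledTree (n + 1) (doubleForkParent a b e c), (f l : ℕ) = n := by
  induction n with
  | zero =>
    intro W _ G hG hn x _ _ hx _ _ l _
    exfalso
    have := Fintype.card_le_one_iff_subsingleton.1 hn.le
    have := valency_le_one_of_unique (G := G) (z := x) (w := x) fun u _ => Subsingleton.elim _ _
    omega
  | succ n ih =>
    intro W _ G hG hn x y hxy hx hy hdeg l hl
    classical
    obtain ⟨v, hvl, hadj, hG', hcard⟩ := exists_leaf_removal hG hn hl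
    have hcard' : Fintype.card ({l}ᶜ : Set W) = n + 1 := by
      rw [← Nat.card_eq_fintype_card]; exact hcard
    have hv := valency_induce_neighbor G hadj hvl
    have hle := fun u : ({l}ᶜ : Set W) => valency_induce_le G u.1 u.2
    have hxl : x ≠ l := fun h => by rw [h] at hx; omega
    have hyl : y ≠ l := fun h => by rw [h] at hy; omega
    by_cases hvxy : v = x ∨ v = y
    · obtain ⟨z, hzv, hzl, hz, hdegz⟩ : ∃ z, z ≠ v ∧ z ≠ l ∧ valency G z = 3 ∧
          ∀ u, u ≠ z → u ≠ v → valency G u ≤ 2 := by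
        rcases hvxy with rfl | rfl
        · exact ⟨y, hxy.symm, hyl, hy, fun u h1 h2 => hdeg u h2 h1⟩
        · exact ⟨x, hxy, hxl, hx, fun u h1 h2 => hdeg u h1 h2⟩
      have hv3 : valency G v = 3 := by rcases hvxy with rfl | rfl <;> assumption
      have hv2 : valency (G.induce {l}ᶜ) ⟨v, hvl⟩ = 2 := by omega
      have hz3 := valency_induce_of_ne G hadj z hzl hzv
      have : Nontrivial ({l}ᶜ : Set W) :=
        ⟨⟨z, hzl⟩, ⟨v, hvl⟩, fun h => hzv (congrArg Subtype.val h)⟩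
      obtain ⟨l', hl'⟩ := exists_isTree_leaf hG'
      obtain ⟨a, b, c, ha, hb, hc, hnab, e, -⟩ := exists_iso_tripod hG' hcard' ⟨z, hzl⟩
        (by omega) (fun u hu => by
          by_cases h : u = ⟨v, hvl⟩
          · rw [h, hv2]
          · exact (hle u).trans
              (hdegz u (fun h' => hu (Subtype.ext h')) fun h' => h (Subtype.ext h'))) l' hl'.le
      obtain ⟨a, b, c, hnab, ha, hb, hc, f, hf1, hf2⟩ := exists_iso_tripod_last_leg (n := n + 1)
        (by omega) ha hb hc (e ⟨v, hvl⟩) (by rw [valency_iso, hv2])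
      obtain ⟨s, hs⟩ : ∃ s : ℕ, s = f (e ⟨v, hvl⟩) := ⟨_, rfl⟩
      rw [← hs] at hf1 hf2
      have hp := tripodParent_spec a b
      have hp' := doubleForkParent_spec a b (s - (a + b)) (n - s)
      obtain ⟨e', he', -⟩ := exists_iso_of_leaf
        (q := doubleForkParent a b (s - (a + b)) (n - s)) hvl hadj (e.trans f)
        (fun i hi => by have := hp i; have := hp' i; omega)
        (by
          change _ = (f (e ⟨v, hvl⟩) : ℕ)
          have := hp' (n + 1); omega)
      exact ⟨a, b, s - (a + b), n - s, 1, ha, hb, by omega, by omega, by omega, by omega, e', he'⟩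
    · rw [not_or] at hvxy
      have hx' := valency_induce_of_ne G hadj x hxl (Ne.symm hvxy.1)
      have hy' := valency_induce_of_ne G hadj y hyl (Ne.symm hvxy.2)
      obtain ⟨a, b, e, c, d, ha, hb, he, hc, hd, hnab, f, hf⟩ := ih hG' hcard' ⟨x, hxl⟩ ⟨y, hyl⟩
        (fun h => hxy (congrArg Subtype.val h)) (by omega) (by omega)
        (fun u hu hu' => (hle u).trans
          (hdeg u (fun h => hu (Subtype.ext h)) fun h => hu' (Subtype.ext h))) ⟨v, hvl⟩
        (by have := hdeg v hvxy.1 hvxy.2; omega)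
      have hp := doubleForkParent_spec a b e c
      obtain ⟨f', hf', -⟩ := exists_iso_of_leaf (q := doubleForkParent a b e c) hvl hadj f
        (fun i _ => rfl) (by have := hp (n + 1); omega)
      exact ⟨a, b, e, c, d + 1, ha, hb, he, hc, by omega, by omega, f', hf'⟩

/-! ### The entropy lower bound -/

section Entropy

variable {W : Type*}

/-- A homomorphism from a labelled tree is a homomorphism from the tree without its last vertex
together with a neighbour of the image of the parent of the last vertex. -/
def labelledTreeHomSucc (G : SimpleGraph W) {k : ℕ} (p : ℕ → ℕ) (hp : p (k + 1) < k + 1) :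
    (labelledTree (k + 2) p →g G) ≃
      Σ φ : labelledTree (k + 1) p →g G, G.neighborSet (φ ⟨p (k + 1), hp⟩) where
  toFun φ := ⟨⟨fun i => φ i.castSucc, fun {i j} h => φ.map_rel (a := i.castSucc)
    (b := j.castSucc) h⟩, φ (Fin.last _), φ.map_rel (a := Fin.castSucc ⟨p (k + 1), hp⟩)
    (b := Fin.last _) (Or.inl ⟨hp, rfl⟩)⟩
  invFun x := ⟨Fin.snoc (α := fun _ => W) x.1 x.2.1, fun {i j} h => by
    induction i using Fin.lastCases with
    | last =>
      induction j using Fin.lastCases with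
      | last => exact absurd h (SimpleGraph.irrefl _)
      | cast j =>
        rw [Fin.snoc_last, Fin.snoc_castSucc]
        rcases h with h | h
        · exact absurd h.1 (Fin.le_last j.castSucc).not_gt
        · have : j = ⟨p (k + 1), hp⟩ := Fin.ext h.2.symm
          rw [this]
          exact x.2.2.symm
    | cast i =>
      induction j using Fin.lastCases with
      | last =>
        rw [Fin.snoc_last, Fin.snoc_castSucc]
        rcases h with h | h
        · have : i = ⟨p (k + 1), hp⟩ := Fin.ext h.2.symm
          rw [this]
          exact x.2.2
        · exact absurd h.1 (Fin.le_last i.castSucc).not_gt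
      | cast j =>
        rw [Fin.snoc_castSucc, Fin.snoc_castSucc]
        exact x.1.map_rel h⟩
  left_inv φ := by
    ext i
    induction i using Fin.lastCases with
    | last => exact Fin.snoc_last (α := fun _ => W) _ _
    | cast i => exact Fin.snoc_castSucc (α := fun _ => W) _ _ _
  right_inv x := by
    obtain ⟨φ, u, hu⟩ := x
    have h : (⟨fun i => Fin.snoc (α := fun _ => W) φ u i.castSucc, fun {i j} h => by
        simp only [Fin.snoc_castSucc]
        exact φ.map_rel h⟩ : labelledTree (k + 1) p →g G) = φ := by
      ext i
      exact Fin.snoc_castSucc (α := fun _ => W) _ _ _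
    refine Sigma.ext h ?_
    refine (Subtype.heq_iff_coe_eq fun w => ?_).2 ?_
    · exact iff_of_eq (congrArg (fun z => G.Adj z w)
        (Fin.snoc_castSucc (α := fun _ => W) u φ ⟨p (k + 1), hp⟩))
    · exact Fin.snoc_last (α := fun _ => W) _ _

/-- Gibbs' inequality for a nonnegative vector `q` of total mass `P` supported on `s`. -/
theorem sum_mul_log_sub_le {ι : Type*} (s : Finset ι) (q w : ι → ℝ) {P : ℝ} (hP : 0 < P)
    (hq : ∀ u ∈ s, 0 ≤ q u) (hsum : ∑ u ∈ s, q u = P) (hw : ∀ u ∈ s, 0 < w u) :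
    ∑ u ∈ s, (q u * Real.log (w u) - q u * Real.log (q u)) + P * Real.log P ≤
      P * Real.log (∑ u ∈ s, w u) := by
  have hs : s.Nonempty := by
    rw [Finset.nonempty_iff_ne_empty]
    rintro rfl
    simp at hsum
    exact hP.ne hsum
  have hΩ : 0 < ∑ u ∈ s, w u := Finset.sum_pos hw hs
  set Ω := ∑ u ∈ s, w u with hΩdef
  -- This is `log z ≤ z - 1` for `z = w u * (P / Ω) / q u`; the linear corrections cancel on
  -- summation, both parts having total `P`.
  have key : ∀ u ∈ s, q u * Real.log (w u) - q u * Real.log (q u) ≤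
      q u * (Real.log Ω - Real.log P) + (w u * (P / Ω) - q u) := by
    intro u hu
    rcases (hq u hu).eq_or_lt with h | h
    · rw [← h]
      have := mul_pos (hw u hu) (div_pos hP hΩ)
      simpa using this.le
    · have hpos : 0 < w u * (P / Ω) / q u := div_pos (mul_pos (hw u hu) (div_pos hP hΩ)) h
      have h1 := Real.log_le_sub_one_of_pos hpos
      rw [Real.log_div (mul_pos (hw u hu) (div_pos hP hΩ)).ne' h.ne',
        Real.log_mul (hw u hu).ne' (div_pos hP hΩ).ne', Real.log_div hP.ne' hΩ.ne'] at h1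
      have h2 := mul_le_mul_of_nonneg_left h1 h.le
      have h3 : q u * (w u * (P / Ω) / q u - 1) = w u * (P / Ω) - q u := by
        field_simp
      rw [h3] at h2
      linarith
  have h := Finset.sum_le_sum key
  rw [Finset.sum_add_distrib, ← Finset.sum_mul,
    Finset.sum_sub_distrib (f := fun u => w u * (P / Ω)),
    ← Finset.sum_mul, hsum, ← hΩdef, mul_div_cancel₀ P hΩ.ne'] at h
  linarith

/-- The weights `ω` make the induction on the source possible. Summing out the last vertex
multiplies the weight at its parent by the sum `Ω x` of the last weight over the neighbours of `x`.
Gibbs' inequality at each `x` then pays for one step of the walk, and the symmetry of `q` keeps the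
marginal equal to `π`. -/
theorem entropy_le_log_weighted [Fintype W] (G : SimpleGraph W) (q : W → W → ℝ) (π : W → ℝ)
    (hq : ∀ x u, 0 ≤ q x u) (hsymm : ∀ x u, q x u = q u x) (hadj : ∀ x u, q x u ≠ 0 → G.Adj x u)
    (hsum : ∀ x, ∑ u, q x u = π x) (hπ : ∀ x, 0 < π x) [Nonempty W] {p : ℕ → ℕ} (k : ℕ) :
    (∀ i, 0 < i → i < k + 1 → p i < i) → ∀ (ω : ℕ → W → ℝ), (∀ i x, 0 < ω i x) →
    ∀ [Fintype (labelledTree (k + 1) p →g G)],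
    (∑ x, π x) * Real.log (∑ x, π x) - ∑ x, π x * Real.log (π x) +
      k * ∑ x, (π x * Real.log (π x) - ∑ u, q x u * Real.log (q x u)) +
      ∑ i ∈ Finset.range (k + 1), ∑ x, π x * Real.log (ω i x) ≤
      (∑ x, π x) * Real.log (∑ φ : labelledTree (k + 1) p →g G, ∏ i : Fin (k + 1), ω i (φ i)) := by
  classical
  induction k with
  | zero =>
    intro _ ω hω _
    have e : ∑ φ : labelledTree (0 + 1) p →g G, ∏ i : Fin (0 + 1), ω i (φ i) = ∑ x, ω 0 x := by
      refine Fintype.sum_bijective (fun φ : labelledTree (0 + 1) p →g G => φ 0)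
        ⟨fun φ ψ h => ?_, fun x => ⟨⟨fun _ => x, fun {i j} h => ?_⟩, rfl⟩⟩ _ _ fun φ => ?_
      · ext i
        rw [show i = 0 from Fin.ext (by omega)]
        exact h
      · rw [show i = j from Fin.ext (by omega)] at h
        exact absurd h (SimpleGraph.irrefl _)
      · simp
    have h := sum_mul_log_sub_le Finset.univ π (ω 0) (P := ∑ x, π x)
      (Finset.sum_pos (fun x _ => hπ x) Finset.univ_nonempty) (fun x _ => (hπ x).le) rfl
      (fun x _ => hω 0 x)
    rw [Finset.sum_sub_distrib] at h
    rw [e]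
    simp only [Nat.cast_zero, zero_mul, zero_add, Finset.sum_range_one]
    linarith
  | succ k ih =>
    intro hp ω hω _
    let _ : Fintype (labelledTree (k + 1) p →g G) := Fintype.ofFinite _
    have hpk : p (k + 1) < k + 1 := hp (k + 1) (by omega) (by omega)
    let Ω : W → ℝ := fun x => ∑ u ∈ G.neighborFinset x, ω (k + 1) u
    have hsupp : ∀ x (g : W → ℝ), ∑ u, q x u * g u = ∑ u ∈ G.neighborFinset x, q x u * g u := by
      intro x g
      refine (Finset.sum_subset (Finset.subset_univ _) fun u _ hu => ?_).symm
      rw [SimpleGraph.mem_neighborFinset] at hu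
      rw [not_not.1 fun h => hu (hadj x u h), zero_mul]
    have hsum' : ∀ x, ∑ u ∈ G.neighborFinset x, q x u = π x := by
      intro x
      have := hsupp x fun _ => 1
      simp only [mul_one] at this
      rw [← this, hsum]
    have hΩ : ∀ x, 0 < Ω x := by
      intro x
      refine Finset.sum_pos (fun u _ => hω _ u) ?_
      rw [Finset.nonempty_iff_ne_empty]
      intro h
      have := hsum' x
      rw [h, Finset.sum_empty] at this
      exact (hπ x).ne this
    let ω' : ℕ → W → ℝ := fun i x => ω i x * if i = p (k + 1) then Ω x else 1
    have hω' : ∀ i x, 0 < ω' i x := by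
      intro i x
      refine mul_pos (hω i x) ?_
      split_ifs
      exacts [hΩ x, one_pos]
    have e : ∑ φ : labelledTree (k + 1 + 1) p →g G, ∏ i : Fin (k + 1 + 1), ω i (φ i) =
        ∑ φ : labelledTree (k + 1) p →g G, ∏ i : Fin (k + 1), ω' i (φ i) := by
      rw [Fintype.sum_equiv (labelledTreeHomSucc G p hpk) _ (fun x =>
        (∏ i : Fin (k + 1), ω i (x.1 i)) * ω (k + 1) x.2.1)
        fun φ => by rw [Fin.prod_univ_castSucc]; rfl, Fintype.sum_sigma]
      refine Finset.sum_congr rfl fun φ _ => ?_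
      simp only [ω']
      rw [Finset.prod_mul_distrib, ← Finset.mul_sum]
      congr 1
      rw [Finset.prod_eq_single (⟨p (k + 1), hpk⟩ : Fin (k + 1))
        (fun i _ hi => if_neg fun h => hi (Fin.ext h)) (by simp), if_pos rfl]
      exact (Finset.sum_subtype (G.neighborFinset (φ ⟨p (k + 1), hpk⟩))
        (fun x => by simp) (ω (k + 1))).symm
    have h := ih (fun i h1 h2 => hp i h1 (by omega)) ω' hω'
    have hlog : ∑ i ∈ Finset.range (k + 1), ∑ x, π x * Real.log (ω' i x) =
        ∑ i ∈ Finset.range (k + 1), ∑ x, π x * Real.log (ω i x) + ∑ x, π x * Real.log (Ω x) := by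
      have : ∀ i, ∑ x, π x * Real.log (ω' i x) = ∑ x, π x * Real.log (ω i x) +
          if i = p (k + 1) then ∑ x, π x * Real.log (Ω x) else 0 := by
        intro i
        by_cases hi : i = p (k + 1)
        · simp only [ω', if_pos hi]
          rw [← Finset.sum_add_distrib]
          refine Finset.sum_congr rfl fun x _ => ?_
          rw [Real.log_mul (hω i x).ne' (hΩ x).ne', mul_add]
        · simp [ω', hi]
      simp only [this]
      rw [Finset.sum_add_distrib, Finset.sum_ite_eq' (Finset.range (k + 1)),
        if_pos (Finset.mem_range.2 hpk)]
    -- Gibbs' inequality for the row `q x`, summed over `x`.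
    have hstep : ∑ x, π x * Real.log (ω (k + 1) x) +
        ∑ x, (π x * Real.log (π x) - ∑ u, q x u * Real.log (q x u)) ≤
        ∑ x, π x * Real.log (Ω x) := by
      have h1 : ∑ x, π x * Real.log (ω (k + 1) x) =
          ∑ x, ∑ u, q x u * Real.log (ω (k + 1) u) := by
        rw [Finset.sum_comm]
        refine Finset.sum_congr rfl fun u _ => ?_
        rw [← Finset.sum_mul, ← hsum u]
        congr 1
        exact Finset.sum_congr rfl fun x _ => hsymm u x
      rw [h1, ← Finset.sum_add_distrib]
      refine Finset.sum_le_sum fun x _ => ?_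
      have h2 := sum_mul_log_sub_le (G.neighborFinset x) (q x) (ω (k + 1)) (hπ x)
        (fun u _ => hq x u) (hsum' x) (fun u _ => hω _ u)
      rw [Finset.sum_sub_distrib, ← hsupp x fun u => Real.log (ω (k + 1) u),
        ← hsupp x fun u => Real.log (q x u)] at h2
      linarith
    rw [e, Finset.sum_range_succ]
    rw [hlog] at h
    push_cast
    linarith

/-- The number of homomorphisms from a tree with `k + 1` vertices is at least the exponential of
the entropy of the random homomorphism driven by the reversible Markov chain with edge
weights `q`. -/
theorem entropy_le_log_homCount [Fintype W] [Nonempty W] (G : SimpleGraph W) (q : W → W → ℝ)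
    (π : W → ℝ) (hq : ∀ x u, 0 ≤ q x u) (hsymm : ∀ x u, q x u = q u x)
    (hadj : ∀ x u, q x u ≠ 0 → G.Adj x u) (hsum : ∀ x, ∑ u, q x u = π x) (hπ : ∀ x, 0 < π x)
    {V : Type*} [Fintype V] {T : SimpleGraph V} (hT : T.IsTree) {k : ℕ}
    (hk : Fintype.card V = k + 1) :
    (∑ x, π x) * Real.log (∑ x, π x) - ∑ x, π x * Real.log (π x) +
      k * ∑ x, (π x * Real.log (π x) - ∑ u, q x u * Real.log (q x u)) ≤
      (∑ x, π x) * Real.log (homCount T G) := by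
  classical
  obtain ⟨p, hp, ⟨e⟩⟩ := exists_iso_labelledTree hT hk
  let _ : Fintype (labelledTree (k + 1) p →g G) := Fintype.ofFinite _
  have h := entropy_le_log_weighted G q π hq hsymm hadj hsum hπ k hp (fun _ _ => 1)
    (fun _ _ => one_pos)
  rw [homCount_congr e (SimpleGraph.Iso.refl (G := G)), homCount, Nat.card_eq_fintype_card]
  simpa using h

end Entropy

/-! ### Upper bounds for paths -/

section PathBounds


variable {V : Type*} {T : SimpleGraph V}

/-- The directions of the `k` edges determine a homomorphism up to translation, and one that hits
the vertex `n` has maximum `n`, which fixes the translation. -/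
theorem homCount_labelledTree_path_succ_le {k n : ℕ} {p : ℕ → ℕ}
    (hp : ∀ i, 0 < i → i < k + 1 → p i < i) :
    homCount (labelledTree (k + 1) p) (pathGraph (n + 1)) ≤
      homCount (labelledTree (k + 1) p) (pathGraph n) + 2 ^ k := by
  classical
  let up : (labelledTree (k + 1) p →g pathGraph (n + 1)) → Fin k → Bool := fun φ i =>
    decide ((φ ⟨p (i + 1), (hp _ (by omega) (by omega)).trans (by omega)⟩ : ℕ) <
      φ ⟨i + 1, by omega⟩)
  let avoids : (labelledTree (k + 1) p →g pathGraph (n + 1)) → Prop := fun φ =>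
    ∀ t, (φ t : ℕ) < n
  let F : (labelledTree (k + 1) p →g pathGraph (n + 1)) →
      (labelledTree (k + 1) p →g pathGraph n) ⊕ (Fin k → Bool) := fun φ =>
    if h : avoids φ then Sum.inl ⟨fun t => ⟨φ t, h t⟩, fun {s t} hst => by
      have := φ.map_rel hst
      rw [pathGraph_adj] at this ⊢
      exact this⟩ else Sum.inr (up φ)
  have hF : Function.Injective F := by
    intro φ ψ h
    by_cases h1 : avoids φ <;> by_cases h2 : avoids ψ
    · simp only [F, dif_pos h1, dif_pos h2, Sum.inl.injEq] at h
      ext t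
      have h3 := Fin.ext_iff.1 (DFunLike.congr_fun h t)
      exact h3
    · simp [F, h1, h2] at h
    · simp [F, h1, h2] at h
    · simp only [F, dif_neg h1, dif_neg h2, Sum.inr.injEq] at h
      -- Equal directions give a constant difference between `φ` and `ψ`.
      have hdiff : ∀ i (hi : i < k + 1), (φ ⟨i, hi⟩ : ℕ) + ψ 0 = ψ ⟨i, hi⟩ + φ 0 := by
        intro i
        induction i using Nat.strong_induction_on with
        | _ i ih =>
          intro hi
          rcases Nat.eq_zero_or_pos i with rfl | hpos
          · exact add_comm _ _
          · obtain ⟨j, rfl⟩ : ∃ j, i = j + 1 := ⟨i - 1, by omega⟩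
            have hpj := hp (j + 1) hpos hi
            have hj := ih _ hpj (by omega)
            have hup := congrFun h ⟨j, by omega⟩
            simp only [up, decide_eq_decide] at hup
            have hadj : (labelledTree (k + 1) p).Adj ⟨p (j + 1), by omega⟩ ⟨j + 1, hi⟩ :=
              Or.inl ⟨hpj, rfl⟩
            have a1 := pathGraph_adj.1 (φ.map_rel hadj)
            have a2 := pathGraph_adj.1 (ψ.map_rel hadj)
            omega
      simp only [avoids, not_forall, not_lt] at h1 h2
      obtain ⟨s, hs⟩ := h1
      obtain ⟨t, ht⟩ := h2
      have b1 := hdiff s s.2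
      have b2 := hdiff t t.2
      have b3 := (φ s).2
      have b4 := (ψ s).2
      have b5 := (φ t).2
      have b6 := (ψ t).2
      simp only [Fin.eta] at b1 b2
      ext i
      have b7 := hdiff i i.2
      simp only [Fin.eta] at b7
      omega
  have := Nat.card_le_card_of_injective F hF
  rw [Nat.card_sum] at this
  simpa [homCount] using this

theorem homCount_path_succ_le [Fintype V] (hT : T.IsTree) {k : ℕ} (hk : Fintype.card V = k + 1)
    (n : ℕ) :
    homCount T (pathGraph (n + 1)) ≤ homCount T (pathGraph n) + 2 ^ k := by
  obtain ⟨p, hp, ⟨e⟩⟩ := exists_iso_labelledTree hT hk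
  rw [homCount_congr e SimpleGraph.Iso.refl,
    homCount_congr e (SimpleGraph.Iso.refl (G := pathGraph n))]
  exact homCount_labelledTree_path_succ_le hp

theorem homCount_path_add_le [Fintype V] (hT : T.IsTree) {k : ℕ} (hk : Fintype.card V = k + 1)
    (n j : ℕ) :
    homCount T (pathGraph (n + j)) ≤ homCount T (pathGraph n) + j * 2 ^ k := by
  induction j with
  | zero => simp
  | succ j ih =>
    have := homCount_path_succ_le hT hk (n + j)
    rw [← add_assoc]
    linarith [add_mul j 1 (2 ^ k)]

theorem homCount_path_two_le (hT : T.IsTree) : homCount T (pathGraph 2) ≤ 2 := by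
  obtain ⟨r⟩ := hT.connected.nonempty
  have hinj : Function.Injective fun φ : T →g pathGraph 2 => φ r := by
    intro φ ψ h
    ext t
    obtain ⟨w⟩ := hT.connected.preconnected r t
    induction w with
    | nil => exact congrArg Fin.val h
    | cons hadj _ ih =>
      refine ih (Fin.ext ?_)
      have h' : φ _ = ψ _ := h
      have a1 := pathGraph_adj.1 (φ.map_rel hadj)
      have a2 := pathGraph_adj.1 (ψ.map_rel hadj)
      rw [h'] at a1
      change (φ _ : ℕ) = ψ _
      omega
  have := Nat.card_le_card_of_injective _ hinj
  simpa [homCount] using this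

theorem homCount_path_le [Fintype V] (hT : T.IsTree) {k : ℕ} (hk : Fintype.card V = k + 1) (j : ℕ) :
    homCount T (pathGraph (j + 2)) ≤ j * 2 ^ k + 2 := by
  have h1 := homCount_path_add_le hT hk 2 j
  have h2 := homCount_path_two_le hT
  rw [add_comm j 2]
  omega

/-- One colour class is sent to the middle vertex, and each vertex of the other class chooses one of
the two ends. -/
theorem homCount_path_three_le [Finite V] (hT : T.IsTree) (col : V → Bool)
    (hcol : ∀ s t, T.Adj s t → col s ≠ col t) :
    homCount T (pathGraph 3) ≤ 2 ^ Nat.card {t // col t = true} +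
      2 ^ Nat.card {t // col t = false} := by
  classical
  have hpar : ∀ φ : T →g pathGraph 3, ∀ s t, (col s = col t ↔ ((φ s : ℕ) = 1 ↔ (φ t : ℕ) = 1)) := by
    intro φ s t
    obtain ⟨w⟩ := hT.connected.preconnected s t
    induction w with
    | nil => simp
    | @cons u v w hadj _ ih =>
      have h1 := hcol _ _ hadj
      have a1 := pathGraph_adj.1 (φ.map_rel hadj)
      have b1 := (φ u).2
      have b2 := (φ v).2
      have h2 : ¬ ((φ u : ℕ) = 1 ↔ (φ v : ℕ) = 1) := by omega
      have h3 : col u = col w ↔ ¬ col v = col w := by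
        revert h1
        cases col u <;> cases col v <;> cases col w <;> simp
      rw [h3, ih]
      tauto
  obtain ⟨r⟩ := hT.connected.nonempty
  let F : (T →g pathGraph 3) →
      ({t // col t = col r} → Bool) ⊕ ({t // col t = !col r} → Bool) := fun φ =>
    if (φ r : ℕ) = 1 then Sum.inr fun t => decide ((φ t : ℕ) = 0)
    else Sum.inl fun t => decide ((φ t : ℕ) = 0)
  have hF : Function.Injective F := by
    intro φ ψ h
    ext t
    have c1 := hpar φ t r
    have c2 := hpar ψ t r
    have b1 := (φ t).2
    have b2 := (ψ t).2
    by_cases h1 : (φ r : ℕ) = 1 <;> by_cases h2 : (ψ r : ℕ) = 1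
    · by_cases ht : col t = col r
      · simp only [ht, true_iff, h1, h2, iff_true] at c1 c2
        omega
      · have ht' : col t = !col r := by
          revert ht
          cases col t <;> cases col r <;> simp
        simp only [F, h1, h2, if_true, Sum.inr.injEq] at h
        have := congrFun h ⟨t, ht'⟩
        simp only [decide_eq_decide] at this
        simp only [ht, false_iff, h1, h2, iff_true] at c1 c2
        omega
    · simp [F, h1, h2] at h
    · simp [F, h1, h2] at h
    · by_cases ht : col t = col r
      · simp only [F, h1, h2, if_false, Sum.inl.injEq] at h
        have := congrFun h ⟨t, ht⟩
        simp only [decide_eq_decide] at this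
        simp only [ht, true_iff, h1, h2, iff_false] at c1 c2
        omega
      · simp only [ht, false_iff, h1, h2, iff_false, not_not] at c1 c2
        omega
  have := Nat.card_le_card_of_injective F hF
  rw [Nat.card_sum, Nat.card_fun, Nat.card_fun] at this
  simp only [Nat.card_eq_fintype_card (α := Bool), Fintype.card_bool] at this
  rw [homCount]
  cases hr : col r
  · rw [hr] at this
    simpa [add_comm] using this
  · rw [hr] at this
    simpa using this

end PathBounds

/-! ### The simple random walk -/

section SimpleWalk

variable {W : Type*} [Fintype W] {G : SimpleGraph W}

theorem homCount_of_subsingleton {V : Type*} [Fintype V] {T : SimpleGraph V}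
    (hV : Fintype.card V = 1) : homCount T G = Fintype.card W := by
  obtain ⟨t, ht⟩ := Fintype.card_eq_one_iff.1 hV
  rw [homCount, ← Nat.card_eq_fintype_card]
  refine Nat.card_congr ⟨fun φ => φ t, fun x => ⟨fun _ => x, fun {a b} h => ?_⟩, fun φ => ?_,
    fun x => rfl⟩
  · rw [ht a, ht b] at h
    exact absurd h (SimpleGraph.irrefl _)
  · ext s
    rw [ht s]
    rfl

theorem sum_valency (hG : G.IsTree) : ∑ x, valency G x + 2 = 2 * Fintype.card W := by
  classical
  have h1 := G.sum_degrees_eq_twice_card_edges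
  have h2 := hG.card_edgeFinset
  simp only [valency_eq_degree]
  omega

theorem valency_pos (hG : G.IsTree) (hW : 1 < Fintype.card W) (x : W) : 0 < valency G x := by
  classical
  have : Nontrivial W := Fintype.one_lt_card_iff_nontrivial.1 hW
  rw [valency_eq_degree]
  exact hG.connected.preconnected.degree_pos_of_nontrivial x

/-- Unit weight on every edge: `π` is the degree, the total mass is twice the number of edges, and a
step from `x` has entropy `log (valency G x)`. -/
theorem simpleWalk_le_log_homCount (hG : G.IsTree) (hW : 1 < Fintype.card W)
    {V : Type*} [Fintype V] {T : SimpleGraph V} (hT : T.IsTree) {k : ℕ}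
    (hk : Fintype.card V = k + 1) :
    (2 * (Fintype.card W - 1) : ℝ) * Real.log (2 * (Fintype.card W - 1)) +
      (k - 1) * ∑ x, (valency G x : ℝ) * Real.log (valency G x) ≤
      (2 * (Fintype.card W - 1) : ℝ) * Real.log (homCount T G) := by
  classical
  have : Nonempty W := hG.connected.nonempty
  have hsum : ∑ x, (valency G x : ℝ) = 2 * (Fintype.card W - 1) := by
    have := sum_valency hG
    have : ((∑ x, valency G x + 2 : ℕ) : ℝ) = ((2 * Fintype.card W : ℕ) : ℝ) := by rw [this]
    push_cast at this
    linarith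
  have h := entropy_le_log_homCount G (fun x u => if G.Adj x u then 1 else 0)
    (fun x => (valency G x : ℝ)) (fun x u => by positivity)
    (fun x u => by simp only [G.adj_comm]) (fun x u h => by by_contra h'; simp [h'] at h)
    (fun x => by
      rw [valency_eq_degree, Finset.sum_boole, SimpleGraph.degree,
        SimpleGraph.neighborFinset_eq_filter])
    (fun x => by exact_mod_cast valency_pos hG hW x) hT hk
  have h0 : ∀ x u, (if G.Adj x u then (1 : ℝ) else 0) *
      Real.log (if G.Adj x u then (1 : ℝ) else 0) = 0 := by
    intro x u
    split_ifs <;> simp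
  simp only [h0, Finset.sum_const_zero, sub_zero, hsum] at h
  linarith

/-- The gain of a vertex of degree `d` over a vertex of degree two. -/
noncomputable def degreeGain (d : ℕ) : ℝ :=
  d * Real.log d - d * Real.log 2 - (d - 2) * Real.log 2

theorem degreeGain_three : degreeGain 3 = 3 * Real.log 3 - 4 * Real.log 2 := by
  simp only [degreeGain]
  push_cast
  ring

theorem two_thirds_le_degreeGain_three : 2 / 3 * Real.log 2 ≤ degreeGain 3 := by
  -- `2 ^ 14 ≤ 3 ^ 9`, to be divided by three after taking logarithms.
  have h : Real.log ((2 : ℝ) ^ 14) ≤ Real.log ((3 : ℝ) ^ 9) :=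
    Real.log_le_log (by norm_num) (by norm_num)
  rw [Real.log_pow, Real.log_pow] at h
  push_cast at h
  rw [degreeGain_three]
  linarith

theorem two_le_degreeGain {d : ℕ} (hd : 4 ≤ d) : 2 * Real.log 2 ≤ degreeGain d := by
  have h : Real.log ((2 : ℝ) ^ 2) ≤ Real.log d :=
    Real.log_le_log (by norm_num) (by norm_num; exact_mod_cast hd)
  rw [Real.log_pow] at h
  push_cast at h
  have h' := mul_le_mul_of_nonneg_left h (Nat.cast_nonneg (α := ℝ) d)
  rw [degreeGain]
  linarith

theorem degreeGain_nonneg {d : ℕ} (hd : 0 < d) : 0 ≤ degreeGain d := by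
  have h2 := Real.log_pos (by norm_num : (1 : ℝ) < 2)
  rcases (by omega : d = 1 ∨ d = 2 ∨ d = 3 ∨ 4 ≤ d) with rfl | rfl | rfl | h
  · simp only [degreeGain, Nat.cast_one, Real.log_one]
    linarith
  · simp [degreeGain]
  · linarith [two_thirds_le_degreeGain_three]
  · linarith [two_le_degreeGain h]

/-- The terms `d - 2` add up to `-2` over a tree. What precedes the gains is the value of the sum
for the path, and gains are never negative, so any subset of vertices may be counted. -/
theorem sum_degreeGain_le (hG : G.IsTree) (hW : 1 < Fintype.card W) (s : Finset W) :
    (2 * (Fintype.card W - 1) : ℝ) * Real.log 2 - 2 * Real.log 2 +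
      ∑ x ∈ s, degreeGain (valency G x) ≤ ∑ x, (valency G x : ℝ) * Real.log (valency G x) := by
  have hsum : ∑ x, (valency G x : ℝ) = 2 * (Fintype.card W - 1) := by
    have := sum_valency hG
    have : ((∑ x, valency G x + 2 : ℕ) : ℝ) = ((2 * Fintype.card W : ℕ) : ℝ) := by rw [this]
    push_cast at this
    linarith
  have h1 : ∑ x ∈ s, degreeGain (valency G x) ≤ ∑ x, degreeGain (valency G x) :=
    Finset.sum_le_sum_of_subset_of_nonneg (Finset.subset_univ s)
      fun x _ _ => degreeGain_nonneg (valency_pos hG hW x)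
  have h2 : ∑ x, degreeGain (valency G x) =
      ∑ x, (valency G x : ℝ) * Real.log (valency G x) -
        2 * Real.log 2 * ∑ x, (valency G x : ℝ) + Fintype.card W * (2 * Real.log 2) := by
    rw [Finset.mul_sum, ← Finset.sum_sub_distrib, ← nsmul_eq_mul, ← Finset.card_univ,
      ← Finset.sum_const, ← Finset.sum_add_distrib]
    refine Finset.sum_congr rfl fun x _ => ?_
    rw [degreeGain]
    ring
  rw [h2, hsum] at h1
  linarith

/-- A tree with a vertex of degree at least four or with three branch vertices receives at least
as many homomorphisms from every tree as the path. -/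
theorem homCount_path_le_of_branching (hG : G.IsTree)
    (hbr : (∃ x, 4 ≤ valency G x) ∨ ∃ s : Finset W, s.card = 3 ∧ ∀ x ∈ s, 3 ≤ valency G x)
    {V : Type*} [Fintype V] {T : SimpleGraph V} (hT : T.IsTree) :
    homCount T (SimpleGraph.pathGraph (Fintype.card W)) ≤ homCount T G := by
  obtain ⟨k, hk⟩ : ∃ k, Fintype.card V = k + 1 :=
    ⟨Fintype.card V - 1, by have := Fintype.card_pos_iff.2 hT.connected.nonempty; omega⟩
  have hW : 1 < Fintype.card W := by
    by_contra hW
    have := Fintype.card_le_one_iff_subsingleton.1 (not_lt.1 hW)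
    have hv : ∀ x, valency G x ≤ 1 := fun x =>
      valency_le_one_of_unique (w := x) fun u _ => Subsingleton.elim _ _
    rcases hbr with ⟨x, hx⟩ | ⟨s, hs, h⟩
    · have := hv x; omega
    · obtain ⟨x, hx⟩ := Finset.card_pos.1 (by omega : 0 < s.card)
      have := hv x; have := h x hx; omega
  rcases Nat.eq_zero_or_pos k with rfl | hk0
  · rw [homCount_of_subsingleton hk, homCount_of_subsingleton hk, Fintype.card_fin]
  have hlog2 := Real.log_pos (by norm_num : (1 : ℝ) < 2)
  -- The path falls short by `2 * Real.log 2`; one degree of at least four or three gains of at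
  -- least `2 / 3 * Real.log 2` make up for it.
  have hS : (2 * (Fintype.card W - 1) : ℝ) * Real.log 2 ≤
      ∑ x, (valency G x : ℝ) * Real.log (valency G x) := by
    by_cases h4 : ∃ x, 4 ≤ valency G x
    · obtain ⟨x, hx⟩ := h4
      have := sum_degreeGain_le hG hW {x}
      rw [Finset.sum_singleton] at this
      linarith [two_le_degreeGain hx]
    · obtain ⟨s, hs, h⟩ := hbr.resolve_left h4
      have h1 := sum_degreeGain_le hG hW s
      have h2 : ∑ x ∈ s, degreeGain (valency G x) = s.card • degreeGain 3 :=
        Finset.sum_eq_card_nsmul fun x hx => by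
          have := h x hx
          have : ¬ 4 ≤ valency G x := fun h' => h4 ⟨x, h'⟩
          rw [show valency G x = 3 by omega]
      rw [h2, hs, nsmul_eq_mul] at h1
      push_cast at h1
      linarith [two_thirds_le_degreeGain_three]
  have hmain := simpleWalk_le_log_homCount hG hW hT hk
  obtain ⟨j, hj⟩ : ∃ j, Fintype.card W = j + 2 := ⟨Fintype.card W - 2, by omega⟩
  obtain ⟨i, rfl⟩ : ∃ i, k = i + 1 := ⟨k - 1, by omega⟩
  have hup := homCount_path_le hT hk j
  rw [hj] at hmain hS ⊢
  push_cast at hmain hS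
  rw [show (2 * ((j : ℝ) + 2 - 1)) = 2 * (j + 1) by ring] at hmain hS
  have hM : (0 : ℝ) < 2 * (j + 1) := by positivity
  have h1 : (2 * (j + 1) : ℝ) * Real.log (2 * (j + 1) * 2 ^ i) ≤
      2 * (j + 1) * Real.log (homCount T G) := by
    rw [Real.log_mul hM.ne' (by positivity), Real.log_pow]
    have := mul_le_mul_of_nonneg_left hS (Nat.cast_nonneg (α := ℝ) i)
    linarith
  have h2 := le_of_mul_le_mul_left h1 hM
  have hpos : (0 : ℝ) < homCount T G := by
    rcases Nat.eq_zero_or_pos (homCount T G) with h | h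
    · rw [h, Nat.cast_zero, Real.log_zero] at h2
      have : 0 < Real.log (2 * (j + 1) * 2 ^ i) := by
        refine Real.log_pos ?_
        have : (1 : ℝ) ≤ 2 ^ i := one_le_pow₀ (by norm_num)
        nlinarith [Nat.cast_nonneg (α := ℝ) j]
      linarith
    · exact_mod_cast h
  have h3 := (Real.log_le_log_iff (by positivity) hpos).1 h2
  have h4 : 2 * (j + 1) * 2 ^ i ≤ homCount T G := by exact_mod_cast h3
  have h5 : 1 ≤ 2 ^ i := Nat.one_le_two_pow
  have h6 : j * 2 ^ (i + 1) + 2 ≤ 2 * (j + 1) * 2 ^ i := by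
    rw [pow_succ]
    nlinarith
  omega

/-- Two branch vertices of degree three nearly close the gap of `2 * Real.log 2`. The remaining loss
is proportional to `i = k - 1` and harmless for small sources. -/
theorem homCount_path_le_of_two_branching (hG : G.IsTree) {x y : W} (hxy : x ≠ y)
    (hx : valency G x = 3) (hy : valency G y = 3) {V : Type*} [Fintype V] {T : SimpleGraph V}
    (hT : T.IsTree) (hV : Fintype.card V ≤ 6) :
    homCount T (SimpleGraph.pathGraph (Fintype.card W)) ≤ homCount T G := by
  classical
  obtain ⟨k, hk⟩ : ∃ k, Fintype.card V = k + 1 :=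
    ⟨Fintype.card V - 1, by have := Fintype.card_pos_iff.2 hT.connected.nonempty; omega⟩
  have hW : 1 < Fintype.card W := Fintype.one_lt_card_iff.2 ⟨x, y, hxy⟩
  rcases Nat.eq_zero_or_pos k with rfl | hk0
  · rw [homCount_of_subsingleton hk, homCount_of_subsingleton hk, Fintype.card_fin]
  have hS := sum_degreeGain_le hG hW {x, y}
  rw [Finset.sum_pair hxy, hx, hy, degreeGain_three] at hS
  -- `5 / 27 = 2 ^ 5 / 3 ^ 3 - 1`; twice this bounds what the two gains lack.
  have hδ : 5 * Real.log 2 - 3 * Real.log 3 ≤ 5 / 27 := by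
    have h := Real.log_le_sub_one_of_pos (by norm_num : (0 : ℝ) < 2 ^ 5 / 3 ^ 3)
    rw [Real.log_div (by norm_num) (by norm_num), Real.log_pow, Real.log_pow] at h
    norm_num at h
    linarith
  have hmain := simpleWalk_le_log_homCount hG hW hT hk
  obtain ⟨j, hj⟩ : ∃ j, Fintype.card W = j + 2 := ⟨Fintype.card W - 2, by omega⟩
  obtain ⟨i, rfl⟩ : ∃ i, k = i + 1 := ⟨k - 1, by omega⟩
  have hup := homCount_path_le hT hk j
  rw [hj] at hmain hS ⊢
  push_cast at hmain hS
  rw [show (2 * ((j : ℝ) + 2 - 1)) = 2 * (j + 1) by ring] at hmain hS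
  have hM : (0 : ℝ) < 2 * (j + 1) := by positivity
  have hpos : (0 : ℝ) < homCount T G := by
    rcases Nat.eq_zero_or_pos (homCount T G) with h | h
    · have h1 : (0 : ℝ) ≤ ∑ x, (valency G x : ℝ) * Real.log (valency G x) :=
        Finset.sum_nonneg fun x _ => mul_nonneg (Nat.cast_nonneg _) (Real.log_natCast_nonneg _)
      have h2 := mul_nonneg (Nat.cast_nonneg (α := ℝ) i) h1
      have h3 : 0 < Real.log (2 * (j + 1) : ℝ) :=
        Real.log_pos (by linarith [Nat.cast_nonneg (α := ℝ) j])
      have h4 := mul_pos hM h3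
      rw [h, Nat.cast_zero, Real.log_zero] at hmain
      linarith
    · exact_mod_cast h
  have h1 : Real.log (2 * (j + 1) * 2 ^ i) - i * (10 / 27) / (2 * (j + 1)) ≤
      Real.log (homCount T G) := by
    refine le_of_mul_le_mul_left ?_ hM
    rw [mul_sub, mul_div_cancel₀ _ hM.ne', Real.log_mul hM.ne' (by positivity), Real.log_pow]
    have := mul_le_mul_of_nonneg_left hS (Nat.cast_nonneg (α := ℝ) i)
    have := mul_le_mul_of_nonneg_left hδ (Nat.cast_nonneg (α := ℝ) i)
    linarith
  have h2 : (2 * (j + 1) * 2 ^ i : ℝ) * (1 - i * (10 / 27) / (2 * (j + 1))) ≤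
      homCount T G := by
    have h3 := Real.exp_le_exp.2 h1
    rw [Real.exp_log hpos, sub_eq_add_neg, Real.exp_add, Real.exp_log (by positivity)] at h3
    refine le_trans (mul_le_mul_of_nonneg_left ?_ (by positivity)) h3
    have := Real.add_one_le_exp (-(i * (10 / 27) / (2 * (j + 1)) : ℝ))
    linarith
  have h3 : (2 * (j + 1) * 2 ^ i : ℝ) * (1 - i * (10 / 27) / (2 * (j + 1))) =
      2 ^ i * (2 * (j + 1) - i * (10 / 27)) := by
    field_simp
  rw [h3] at h2
  have h4 : ((j * 2 ^ (i + 1) + 2 : ℕ) : ℝ) ≤ 2 ^ i * (2 * (j + 1) - i * (10 / 27)) := by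
    push_cast
    have hi : i ≤ 4 := by omega
    -- What is left is `2 ≤ 2 ^ i * (2 - i * (10 / 27))`.
    interval_cases i <;> norm_num <;> linarith
  have h5 : j * 2 ^ (i + 1) + 2 ≤ homCount T G := by exact_mod_cast h4.trans h2
  omega

end SimpleWalk

/-! ### Tripods -/

instance (p : ℕ → ℕ) (u v : ℕ) : Decidable (ParentLink p u v) :=
  inferInstanceAs (Decidable ((u < v ∧ p v = u) ∨ (v < u ∧ p u = v)))

instance (n : ℕ) (p : ℕ → ℕ) : DecidableRel (labelledTree n p).Adj :=
  fun i j => inferInstanceAs (Decidable (ParentLink p i j))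

instance (a b c : ℕ) : DecidableRel (tripod a b c).Adj :=
  inferInstanceAs (DecidableRel (labelledTree _ (tripodParent a b)).Adj)

/-- The edge weights of the maximal entropy random walk on `tripod 3 3 1`. -/
def tripodThreeThreeOneWeight : Fin 8 → Fin 8 → ℕ :=
  ![![0, 2, 0, 0, 0, 0, 0, 0], ![2, 0, 6, 0, 0, 0, 0, 0], ![0, 6, 0, 12, 0, 0, 0, 0],
    ![0, 0, 12, 0, 12, 0, 0, 8], ![0, 0, 0, 12, 0, 6, 0, 0], ![0, 0, 0, 0, 6, 0, 2, 0],
    ![0, 0, 0, 0, 0, 2, 0, 0], ![0, 0, 0, 8, 0, 0, 0, 0]]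

section TripodBound

variable {V : Type*} {T : SimpleGraph V}

/-- This tripod has spectral radius `2` with eigenvector `(1, 2, 3, 4, 3, 2, 1, 2)`. The weight of
an edge is the product of its two entries, `π` is twice the squared entry, and the walk gains
exactly `log 2` per step. The constant is the exponential of the entropy of `π`. -/
theorem tripod_three_three_one_entropy [Fintype V] (hT : T.IsTree) {k : ℕ}
    (hk : Fintype.card V = k + 1) :
    59 * 2 ^ k ≤ 10 * homCount T (tripod 3 3 1) := by
  have hadj : ∀ x u : Fin 8, tripodThreeThreeOneWeight x u ≠ 0 → (tripod 3 3 1).Adj x u := by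
    decide
  have hsymm : ∀ x u, tripodThreeThreeOneWeight x u = tripodThreeThreeOneWeight u x := by decide
  let π : Fin 8 → ℕ := ![2, 8, 18, 32, 18, 8, 2, 8]
  have hsum : ∀ x, ∑ u, tripodThreeThreeOneWeight x u = π x := by decide
  have hπ : ∀ x, 0 < π x := by decide
  have h := entropy_le_log_homCount (W := Fin 8) (tripod 3 3 1)
    (fun x u => (tripodThreeThreeOneWeight x u : ℝ)) (fun x => (π x : ℝ))
    (fun x u => Nat.cast_nonneg _) (fun x u => by rw [hsymm])
    (fun x u hxu => hadj x u (by exact_mod_cast hxu))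
    (fun x => by rw [← hsum]; push_cast; rfl) (fun x => by exact_mod_cast hπ x) hT hk
  simp only [Fin.sum_univ_eight] at h
  simp [π, tripodThreeThreeOneWeight] at h
  have hpow : ∀ i j : ℕ, Real.log ((2 : ℝ) ^ i * 3 ^ j) = i * Real.log 2 + j * Real.log 3 :=
    fun i j => by rw [Real.log_mul (by positivity) (by positivity), Real.log_pow, Real.log_pow]
  have l6 := hpow 1 1
  have l8 := hpow 3 0
  have l12 := hpow 2 1
  have l18 := hpow 1 2
  have l32 := hpow 5 0
  have l96 := hpow 5 1
  norm_num at l6 l8 l12 l18 l32 l96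
  rw [show (2 + 8 + 18 + 32 + 18 + 8 + 2 + 8 : ℝ) = 96 by norm_num, l6, l8, l12, l18, l32, l96] at h
  have hmain : 26 * Real.log 2 + 3 * Real.log 3 + 12 * (k * Real.log 2) ≤
      12 * Real.log (homCount T (tripod 3 3 1)) := by
    linarith
  have hpos : (0 : ℝ) < homCount T (tripod 3 3 1) := by
    rcases Nat.eq_zero_or_pos (homCount T (tripod 3 3 1)) with h0 | h0
    · rw [h0, Nat.cast_zero, Real.log_zero] at hmain
      have h2 := Real.log_pos (by norm_num : (1 : ℝ) < 2)
      have h3 := Real.log_pos (by norm_num : (1 : ℝ) < 3)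
      have := mul_nonneg (Nat.cast_nonneg (α := ℝ) k) h2.le
      linarith
    · exact_mod_cast h0
  have hlog : Real.log (2 ^ 26 * 3 ^ 3 * (2 ^ k) ^ 12) ≤
      Real.log ((homCount T (tripod 3 3 1) : ℝ) ^ 12) := by
    rw [Real.log_mul (by positivity) (by positivity), hpow, Real.log_pow, Real.log_pow,
      Real.log_pow]
    push_cast
    linarith
  have hle := (Real.log_le_log_iff (by positivity) (by positivity)).1 hlog
  have hle' : 2 ^ 26 * 3 ^ 3 * (2 ^ k) ^ 12 ≤ homCount T (tripod 3 3 1) ^ 12 := by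
    exact_mod_cast hle
  -- The twelfth root of `2 ^ 26 * 3 ^ 3` is about `5.908`, rounded down to `59 / 10`.
  refine (Nat.pow_le_pow_iff_left (by norm_num : 12 ≠ 0)).1 ?_
  calc (59 * 2 ^ k) ^ 12 = 59 ^ 12 * (2 ^ k) ^ 12 := mul_pow _ _ _
    _ ≤ 10 ^ 12 * (2 ^ 26 * 3 ^ 3) * (2 ^ k) ^ 12 := Nat.mul_le_mul_right _ (by norm_num)
    _ = 10 ^ 12 * (2 ^ 26 * 3 ^ 3 * (2 ^ k) ^ 12) := by ring
    _ ≤ 10 ^ 12 * homCount T (tripod 3 3 1) ^ 12 := Nat.mul_le_mul_left _ hle'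
    _ = (10 * homCount T (tripod 3 3 1)) ^ 12 := (mul_pow _ _ _).symm

theorem sum_degree_pow_le_homCount_of_star [Fintype V] {W : Type*} [Fintype W] (G : SimpleGraph W)
    [DecidableRel G.Adj] {k : ℕ} (hk : Fintype.card V = k + 1) (c : V)
    (hc : ∀ s t, T.Adj s t → s = c ∨ t = c) : ∑ v, G.degree v ^ k ≤ homCount T G := by
  classical
  let F : (Σ v : W, ({t : V // t ≠ c} → G.neighborSet v)) → (T →g G) := fun x =>
    ⟨fun t => if h : t = c then x.1 else x.2 ⟨t, h⟩, fun {s t} hst => by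
      by_cases hs : s = c
      · have ht : t ≠ c := fun h => hst.ne (hs.trans h.symm)
        simp only [hs, ht, dif_pos, dif_neg, not_false_eq_true]
        exact (x.2 ⟨t, ht⟩).2
      · have ht : t = c := (hc s t hst).resolve_left hs
        simp only [hs, ht, dif_pos, dif_neg, not_false_eq_true]
        exact (x.2 ⟨s, hs⟩).2.symm⟩
  have hF : Function.Injective F := by
    rintro ⟨v, f⟩ ⟨w, g⟩ h
    have hfun : ∀ t, (if h : t = c then v else (f ⟨t, h⟩ : W)) =
        if h : t = c then w else (g ⟨t, h⟩ : W) := fun t => DFunLike.congr_fun h t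
    obtain rfl : v = w := by simpa using hfun c
    congr 1
    ext t
    simpa [t.2] using hfun t
  have hle := Nat.card_le_card_of_injective F hF
  have hcard : Fintype.card {t : V // t ≠ c} = k := by
    rw [Fintype.card_subtype_compl, hk, Fintype.card_subtype_eq]
    rfl
  rw [Nat.card_eq_fintype_card, Fintype.card_sigma] at hle
  simp only [Fintype.card_fun, hcard, SimpleGraph.card_neighborSet_eq_degree] at hle
  exact hle

theorem tripod_three_three_one_of_star [Fintype V] {k : ℕ} (hk : Fintype.card V = k + 1)
    (hk0 : 0 < k) (c : V)
    (hc : ∀ s t, T.Adj s t → s = c ∨ t = c) :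
    6 * 2 ^ k + 2 ≤ homCount T (tripod 3 3 1) := by
  have h := sum_degree_pow_le_homCount_of_star (tripod 3 3 1) hk c hc
  have hdeg : ∀ v : Fin 8, (tripod 3 3 1).degree v = (![1, 2, 2, 3, 2, 2, 1, 1] : Fin 8 → ℕ) v := by
    decide
  have hsum : ∑ v : Fin 8, (tripod 3 3 1).degree v ^ k = 3 ^ k + 4 * 2 ^ k + 3 := by
    simp only [hdeg, Fin.sum_univ_eight]
    simp
    ring
  have h3 : 2 * 2 ^ k ≤ 3 ^ k + 1 := by
    clear h hsum hk
    induction k, hk0 using Nat.le_induction with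
    | base => norm_num
    | succ k _ ih =>
      rw [pow_succ, pow_succ]
      have : 1 ≤ 3 ^ k := Nat.one_le_pow _ _ (by norm_num)
      omega
  have h' : 3 ^ k + 4 * 2 ^ k + 3 ≤ homCount T (tripod 3 3 1) := hsum ▸ h
  omega

/-- If both colour classes have at least two vertices, few homomorphisms go to `P_3`, so at most
about `4.5 * 2 ^ k` go to `P_7`, and the entropy bound `5.9 * 2 ^ k` leaves room for another `2 ^
k`. If a class is a single vertex, the source is a star and its homomorphisms are counted by powers
of degrees. -/
theorem homCount_path_seven_add_le [Fintype V] (hT : T.IsTree) {k : ℕ}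
    (hk : Fintype.card V = k + 1) :
    homCount T (pathGraph 7) + 2 ^ k ≤ homCount T (tripod 3 3 1) := by
  classical
  rcases Nat.eq_zero_or_pos k with rfl | hk0
  · rw [homCount_of_subsingleton hk, homCount_of_subsingleton hk]
    simp
  obtain ⟨C⟩ : T.Colorable 2 := hT.colorable_two
  let col : V → Bool := fun t => decide (C t = 0)
  have hcol : ∀ s t, T.Adj s t → col s ≠ col t := by
    intro s t h
    have := C.valid h
    simp only [col, ne_eq, decide_eq_decide]
    omega
  have hstar : ∀ b : Bool, Nat.card {t // col t = b} = 1 →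
      homCount T (pathGraph 7) + 2 ^ k ≤ homCount T (tripod 3 3 1) := by
    intro b hb
    rw [Nat.card_eq_fintype_card, Fintype.card_eq_one_iff] at hb
    obtain ⟨⟨c, hcb⟩, hc⟩ := hb
    have h1 := tripod_three_three_one_of_star (T := T) hk hk0 c fun s t hst => by
      have hne := hcol s t hst
      by_cases hs : col s = b
      · exact Or.inl (congrArg Subtype.val (hc ⟨s, hs⟩))
      · refine Or.inr (congrArg Subtype.val (hc ⟨t, ?_⟩))
        revert hne hs
        cases col s <;> cases col t <;> cases b <;> simp
    have h2 : homCount T (pathGraph 7) ≤ 5 * 2 ^ k + 2 := homCount_path_le hT hk 5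
    omega
  have hpos : ∀ b : Bool, 0 < Nat.card {t // col t = b} := by
    intro b
    have : Nontrivial V := Fintype.one_lt_card_iff_nontrivial.1 (by omega)
    obtain ⟨s⟩ := hT.connected.nonempty
    obtain ⟨t, hst⟩ := hT.connected.preconnected.exists_adj_of_nontrivial s
    have hne := hcol s t hst
    rw [Nat.card_eq_fintype_card, Fintype.card_pos_iff]
    by_cases hs : col s = b
    · exact ⟨s, hs⟩
    · refine ⟨t, ?_⟩
      revert hne hs
      cases col s <;> cases col t <;> cases b <;> simp
  have hadd : Nat.card {t // col t = true} + Nat.card {t // col t = false} = k + 1 := by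
    rw [← hk, ← Fintype.card_congr (Equiv.sigmaFiberEquiv col), Fintype.card_sigma,
      Fintype.sum_bool, Nat.card_eq_fintype_card, Nat.card_eq_fintype_card]
  by_cases h1 : Nat.card {t // col t = true} = 1
  · exact hstar true h1
  by_cases h2 : Nat.card {t // col t = false} = 1
  · exact hstar false h2
  have ha := hpos true
  have hb := hpos false
  obtain ⟨i, hi⟩ : ∃ i, Nat.card {t // col t = true} = i + 2 :=
    ⟨Nat.card {t // col t = true} - 2, by omega⟩
  obtain ⟨j, hj⟩ : ∃ j, Nat.card {t // col t = false} = j + 2 :=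
    ⟨Nat.card {t // col t = false} - 2, by omega⟩
  have h3 := homCount_path_three_le hT col hcol
  have h4 : homCount T (pathGraph 7) ≤ homCount T (pathGraph 3) + 4 * 2 ^ k :=
    homCount_path_add_le hT hk 3 4
  have h5 := tripod_three_three_one_entropy hT hk
  obtain rfl : k = i + j + 3 := by omega
  rw [hi, hj] at h3
  have hi1 : 1 ≤ 2 ^ i := Nat.one_le_two_pow
  have hj1 : 1 ≤ 2 ^ j := Nat.one_le_two_pow
  -- Expand `(2 ^ i - 1) * (2 ^ j - 1) ≥ 0`.
  have h6 : 2 ^ i + 2 ^ j ≤ 2 ^ i * 2 ^ j + 1 := by nlinarith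
  have h7 : 1 ≤ 2 ^ i * 2 ^ j := Nat.mul_pos hi1 hj1
  rw [pow_add, pow_add] at h5 h4 ⊢
  rw [pow_add, pow_add] at h3
  norm_num at h3 h4 h5 ⊢
  -- For `i = j = 0` integrality matters: `472 ≤ 10 * hom` must yield `48 ≤ hom`.
  omega

/-- Homomorphisms to `tripod a b 1` that miss the pendant vertex are those to the long path. Those
to `tripod 3 3 1` that use its pendant vertex give, via a copy around the branch vertex, ones that
use the pendant vertex of `tripod a b 1`; the others go to `P_7`. -/
theorem homCount_path_add_le_tripod_one [Finite V] {a b : ℕ} (ha : 3 ≤ a) (hb : 3 ≤ b) :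
    homCount T (pathGraph (a + b + 1)) + homCount T (tripod 3 3 1) ≤
      homCount T (tripod a b 1) + homCount T (pathGraph 7) := by
  classical
  have hp := tripodParent_spec a b
  have hp3 := tripodParent_spec 3 3
  let ι : pathGraph (a + b + 1) →g tripod a b 1 := ⟨Fin.castSucc, fun {i j} h => by
    rw [pathGraph_adj] at h
    have := hp i
    have := hp j
    change ParentLink _ (i : ℕ) (j : ℕ)
    unfold ParentLink
    omega⟩
  -- The shift by `a - 3` matches the branch vertices `3` and `a`; label `7` is the pendant vertex.
  obtain ⟨f, hf⟩ : ∃ f : ℕ → ℕ, ∀ y, (y < 7 ∧ f y = y + (a - 3)) ∨ (7 ≤ y ∧ f y = a + b + 1) :=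
    ⟨fun y => if y < 7 then y + (a - 3) else a + b + 1, fun y => by
      dsimp only; split_ifs <;> omega⟩
  let ε : tripod 3 3 1 →g tripod a b 1 :=
    ⟨fun i => ⟨f i, by have := hf i; omega⟩, fun {i j} h => by
      have := hf i
      have := hf j
      have := hp (f i)
      have := hp (f j)
      have := hp3 i
      have := hp3 j
      have := i.2
      have := j.2
      change ParentLink _ (i : ℕ) (j : ℕ) at h
      change ParentLink _ (f i) (f j)
      unfold ParentLink at h ⊢
      omega⟩
  let F : (T →g pathGraph (a + b + 1)) ⊕ (T →g tripod 3 3 1) →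
      (T →g tripod a b 1) ⊕ (T →g pathGraph 7) := fun x =>
    match x with
    | Sum.inl φ => Sum.inl (ι.comp φ)
    | Sum.inr ψ => if h : ∀ t, (ψ t : ℕ) < 7 then
        Sum.inr ⟨fun t => ⟨ψ t, h t⟩, fun {s t} hst => by
          have h1 : ParentLink _ (ψ s : ℕ) (ψ t : ℕ) := ψ.map_rel hst
          have := hp3 (ψ s)
          have := hp3 (ψ t)
          have := h s
          have := h t
          rw [pathGraph_adj]
          unfold ParentLink at h1
          change (ψ s : ℕ) + 1 = ψ t ∨ (ψ t : ℕ) + 1 = ψ s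
          omega⟩
      else Sum.inl (ε.comp ψ)
  have hF : Function.Injective F := by
    have hmix : ∀ (φ : T →g pathGraph (a + b + 1)) (ψ : T →g tripod 3 3 1),
        F (Sum.inl φ) ≠ F (Sum.inr ψ) := by
      intro φ ψ h
      by_cases hψ : ∀ t, (ψ t : ℕ) < 7
      · simp [F, hψ] at h
      · simp only [F, dif_neg hψ, Sum.inl.injEq] at h
        push Not at hψ
        obtain ⟨t, ht⟩ := hψ
        have h1 : (φ t : ℕ) = f (ψ t) := Fin.ext_iff.1 (DFunLike.congr_fun h t)
        have := hf (ψ t)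
        have := (φ t).2
        omega
    rintro (φ | φ) (ψ | ψ) h
    · simp only [F, Sum.inl.injEq] at h
      congr 1
      ext t
      have h1 := Fin.ext_iff.1 (DFunLike.congr_fun h t)
      exact h1
    · exact absurd h (hmix φ ψ)
    · exact absurd h.symm (hmix ψ φ)
    · congr 1
      by_cases h1 : ∀ t, (φ t : ℕ) < 7 <;> by_cases h2 : ∀ t, (ψ t : ℕ) < 7
      · simp only [F, dif_pos h1, dif_pos h2, Sum.inr.injEq] at h
        ext t
        have h3 := Fin.ext_iff.1 (DFunLike.congr_fun h t)
        exact h3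
      · simp [F, h1, h2] at h
      · simp [F, h1, h2] at h
      · simp only [F, dif_neg h1, dif_neg h2, Sum.inl.injEq] at h
        ext t
        have h3 : f (φ t) = f (ψ t) := Fin.ext_iff.1 (DFunLike.congr_fun h t)
        have := hf (φ t)
        have := hf (ψ t)
        have := (φ t).2
        have := (ψ t).2
        omega
  have := Nat.card_le_card_of_injective F hF
  rwa [Nat.card_sum, Nat.card_sum] at this

theorem homCount_path_le_tripod_one [Fintype V] (hT : T.IsTree) {a b : ℕ} (ha : 3 ≤ a)
    (hb : 3 ≤ b) :
    homCount T (pathGraph (a + b + 2)) ≤ homCount T (tripod a b 1) := by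
  obtain ⟨k, hk⟩ : ∃ k, Fintype.card V = k + 1 :=
    ⟨Fintype.card V - 1, by have := Fintype.card_pos_iff.2 hT.connected.nonempty; omega⟩
  have h1 := homCount_path_succ_le hT hk (a + b + 1)
  have h2 := homCount_path_add_le_tripod_one (T := T) ha hb
  have h3 := homCount_path_seven_add_le hT hk
  change homCount T (pathGraph (a + b + 1 + 1)) ≤ _
  omega

theorem homCount_tripod_congr (T : SimpleGraph V) {n a b c : ℕ} (hn : n = a + b + c + 1) :
    homCount T (labelledTree n (tripodParent a b)) = homCount T (tripod a b c) := by
  subst hn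
  rfl

theorem homCount_tripod_swap_left (T : SimpleGraph V) (a b c : ℕ) :
    homCount T (tripod a b c) = homCount T (tripod b a c) := by
  obtain ⟨e, -⟩ := exists_iso_tripod_swap_left a b c rfl
  rw [← homCount_tripod_congr T (by omega : a + b + c + 1 = b + a + c + 1)]
  exact homCount_congr SimpleGraph.Iso.refl e

theorem homCount_tripod_swap_right (T : SimpleGraph V) (a b c : ℕ) :
    homCount T (tripod a b c) = homCount T (tripod a c b) := by
  obtain ⟨e, -⟩ := exists_iso_tripod_swap_right a b c rfl
  rw [← homCount_tripod_congr T (by omega : a + b + c + 1 = a + c + b + 1)]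
  exact homCount_congr SimpleGraph.Iso.refl e

/-- Shift with third leg `0`: the starting tripod is then the path itself. -/
theorem homCount_path_le_tripod_of_even_right [Finite V] (T : SimpleGraph V) {n a b c : ℕ}
    (hn : n = a + b + c + 1) (hc0 : 0 < c) (hc : Even c) :
    homCount T (pathGraph n) ≤ homCount T (tripod a b c) := by
  obtain ⟨t, rfl⟩ := hc
  have h := homCount_tripod_le_shift T (a := a) (b := b) (c := 0) (t := t) (by omega) (by omega)
  have hp := tripodParent_spec (a + 2 * t) b
  have h1 : homCount T (tripod (a + 2 * t) b 0) = homCount T (pathGraph n) := by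
    rw [← homCount_tripod_congr T (n := n) (by omega), ← labelledTree_pred]
    refine congrArg _ (labelledTree_congr fun i hi => ?_)
    have := hp i
    omega
  rw [← h1]
  rwa [show t + t = 0 + 2 * t by omega]

/-- A tripod with a leg of even length, or with two legs of length at least three, receives at
least as many homomorphisms from every tree as the path. -/
theorem homCount_path_le_tripod [Fintype V] (hT : T.IsTree) {n a b c : ℕ} (hn : n = a + b + c + 1)
    (ha : 0 < a) (hb : 0 < b) (hc : 0 < c)
    (h : Even a ∨ Even b ∨ Even c ∨ (3 ≤ a ∧ 3 ≤ b) ∨ (3 ≤ b ∧ 3 ≤ c) ∨ (3 ≤ a ∧ 3 ≤ c)) :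
    homCount T (pathGraph n) ≤ homCount T (tripod a b c) := by
  -- An odd leg `c = 2 * t + 1` is shortened to `1`, the surplus making the first leg at least
  -- three.
  have key : ∀ a b c : ℕ, n = a + b + c + 1 → 0 < a → 3 ≤ b → 3 ≤ c → Odd c →
      homCount T (pathGraph n) ≤ homCount T (tripod a b c) := by
    rintro a b c hn ha hb hc ⟨t, rfl⟩
    have h1 := homCount_tripod_le_shift T (a := a) (b := b) (c := 1) (t := t) (by omega) (by omega)
    rw [add_comm 1 (2 * t)] at h1
    refine le_trans ?_ h1
    have h2 := homCount_path_le_tripod_one hT (a := a + 2 * t) (b := b) (by omega) hb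
    obtain rfl : n = a + 2 * t + b + 2 := by omega
    exact h2
  by_cases hca : Even c
  · exact homCount_path_le_tripod_of_even_right T hn hc hca
  by_cases hba : Even b
  · rw [homCount_tripod_swap_right]
    exact homCount_path_le_tripod_of_even_right T (by omega) hb hba
  by_cases haa : Even a
  · rw [homCount_tripod_swap_left, homCount_tripod_swap_right]
    exact homCount_path_le_tripod_of_even_right T (by omega) ha haa
  rw [Nat.not_even_iff_odd] at hca hba haa
  rcases h with h | h | h | ⟨h1, h2⟩ | ⟨h1, h2⟩ | ⟨h1, h2⟩
  · exact absurd h (Nat.not_even_iff_odd.2 haa)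
  · exact absurd h (Nat.not_even_iff_odd.2 hba)
  · exact absurd h (Nat.not_even_iff_odd.2 hca)
  · rw [homCount_tripod_swap_right, homCount_tripod_swap_left]
    exact key c a b (by omega) hc h1 h2 hba
  · exact key a b c hn ha h1 h2 hca
  · rw [homCount_tripod_swap_left]
    exact key b a c (by omega) hb h1 h2 hca

end TripodBound

/-! ### Double forks -/

section DoubleForkWalk

/-- The neighbours of a vertex of a double fork are its parent, its successor and the first
vertices of the branches leaving it. -/
theorem sum_doubleFork_neighbors {a b e c d n : ℕ} (hn : n = a + b + e + c + d + 1) (hb : 0 < b)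
    (he : 0 < e) (hc : 0 < c) (hd : 0 < d) (x : ℕ) (hx : x < n) (f : ℕ → ℝ) :
    ∑ u ∈ Finset.range n, (if ParentLink (doubleForkParent a b e c) x u then f u else 0) =
      (if 0 < x then f (doubleForkParent a b e c x) else 0) +
      (if x + 1 < n ∧ x ≠ a + b ∧ x ≠ a + b + e + c then f (x + 1) else 0) +
      (if x = a then f (a + b + 1) else 0) +
      (if x = a + b + e then f (a + b + e + c + 1) else 0) := by
  have hp := doubleForkParent_spec a b e c
  have hsingle : ∀ (P : Prop) [Decidable P] (y : ℕ), (P → y < n) →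
      (if P then f y else 0) = ∑ u ∈ Finset.range n, if P ∧ u = y then f u else 0 := by
    intro P _ y hy
    by_cases hP : P
    · simp only [hP, true_and, if_true]
      rw [Finset.sum_ite_eq' (Finset.range n) y f, if_pos (Finset.mem_range.2 (hy hP))]
    · simp [hP]
  have hpx := hp x
  rw [hsingle (0 < x) _ (fun _ => by omega), hsingle (x + 1 < n ∧ _) _ (fun h => h.1),
    hsingle (x = a) _ (fun _ => by omega), hsingle (x = a + b + e) _ (fun _ => by omega),
    ← Finset.sum_add_distrib, ← Finset.sum_add_distrib, ← Finset.sum_add_distrib]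
  refine Finset.sum_congr rfl fun u hu => ?_
  rw [Finset.mem_range] at hu
  have hpu := hp u
  have hlink : (if ParentLink (doubleForkParent a b e c) x u then f u else 0) =
      if (x < u ∧ doubleForkParent a b e c u = x) ∨ (u < x ∧ doubleForkParent a b e c x = u)
        then f u else 0 := if_congr Iff.rfl rfl rfl
  rw [hlink]
  by_cases h1 : 0 < x ∧ u = doubleForkParent a b e c x
  · rw [if_pos (by omega), if_pos h1, if_neg (by omega), if_neg (by omega), if_neg (by omega)]
    ring
  rw [if_neg h1]
  by_cases h2 : (x + 1 < n ∧ x ≠ a + b ∧ x ≠ a + b + e + c) ∧ u = x + 1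
  · rw [if_pos (by omega), if_pos h2, if_neg (by omega), if_neg (by omega)]
    ring
  rw [if_neg h2]
  by_cases h3 : x = a ∧ u = a + b + 1
  · rw [if_pos (by omega), if_pos h3, if_neg (by omega)]
    ring
  rw [if_neg h3]
  by_cases h4 : x = a + b + e ∧ u = a + b + e + c + 1
  · rw [if_pos (by omega), if_pos h4]
    ring
  rw [if_neg h4, if_neg (by omega)]
  ring

/-- Sums by type of vertex: `A` at the four leaves, `B` at the branch vertices, `C` inside the
connecting path, `D` in the middle of a leg of length two. -/
theorem sum_doubleFork_short {e c d n : ℕ} (he : 0 < e) (hc : c = 1 ∨ c = 2) (hd : d = 1 ∨ d = 2)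
    (hn : n = e + c + d + 3) (F : ℕ → ℝ) {A B C D : ℝ} (h0 : F 0 = A) (h1 : F 1 = B)
    (h2 : F 2 = A) (hm : ∀ x, 3 ≤ x → x < e + 2 → F x = C) (hw : F (e + 2) = B)
    (hl : F (e + 2 + c) = A) (hl' : F (e + 2 + c + d) = A) (hcD : c = 2 → F (e + 3) = D)
    (hdD : d = 2 → F (e + 3 + c) = D) :
    ∑ x ∈ Finset.range n, F x = 4 * A + 2 * B + (e - 1) * C + (c + d - 2) * D := by
  obtain ⟨i, rfl⟩ : ∃ i, e = i + 1 := ⟨e - 1, by omega⟩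
  have hmid : ∑ x ∈ Finset.range i, F (3 + x) = i * C := by
    rw [Finset.sum_congr rfl fun x hx => hm (3 + x) (by omega)
      (by rw [Finset.mem_range] at hx; omega), Finset.sum_const, Finset.card_range, nsmul_eq_mul]
  have e1 : n = 3 + i + (1 + (c + d)) := by omega
  rw [e1, Finset.sum_range_add, Finset.sum_range_add, hmid]
  have e2 : 3 + i = i + 1 + 2 := by omega
  rw [e2]
  rcases hc with rfl | rfl <;> rcases hd with rfl | rfl <;>
    simp only [Finset.sum_range_succ, Finset.sum_range_zero] <;>
    push_cast <;> simp only [add_zero] <;> rw [h0, h1, h2, hw]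
  · rw [show i + 1 + 2 + 1 + 1 = i + 1 + 2 + (1 + 1) by omega] at hl'
    rw [hl, hl']
    ring
  · have := hdD rfl
    rw [show i + 1 + 3 + 1 = i + 1 + 2 + (1 + 1) by omega] at this
    rw [show i + 1 + 2 + 1 + 2 = i + 1 + 2 + (1 + 2) by omega] at hl'
    rw [hl, hl', this]
    ring
  · have := hcD rfl
    rw [show i + 1 + 3 = i + 1 + 2 + 1 by omega] at this
    rw [show i + 1 + 2 + 2 = i + 1 + 2 + (1 + 1) by omega] at hl
    rw [show i + 1 + 2 + 2 + 1 = i + 1 + 2 + (1 + 2) by omega] at hl'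
    rw [hl, hl', this]
    ring
  · have h3 := hcD rfl
    have h4 := hdD rfl
    rw [show i + 1 + 3 = i + 1 + 2 + 1 by omega] at h3
    rw [show i + 1 + 3 + 2 = i + 1 + 2 + (1 + 2) by omega] at h4
    rw [show i + 1 + 2 + 2 = i + 1 + 2 + (1 + 1) by omega] at hl
    rw [show i + 1 + 2 + 2 + 2 = i + 1 + 2 + (1 + 3) by omega] at hl'
    rw [hl, hl', h3, h4]
    ring

variable {V : Type*} [Fintype V] {T : SimpleGraph V}

/-- Edges of the connecting path get weight `2` and edges of the legs weight `1`. The total mass is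
`4 * e + 2 * t`, and the entropy rate is exactly `log 2`. -/
theorem doubleFork_short_entropy (hT : T.IsTree) {k : ℕ} (hk : Fintype.card V = k + 1)
    {e c d : ℕ} (he : 0 < e) (hc : c = 1 ∨ c = 2) (hd : d = 1 ∨ d = 2) :
    let t : ℝ := c + d + 2
    (4 * e + 2 * t) * Real.log (4 * e + 2 * t) - (8 * e + 2 * t) * Real.log 2 +
        k * ((4 * e + 2 * t) * Real.log 2) ≤
      (4 * e + 2 * t) * Real.log (homCount T (doubleFork 1 1 e c d)) := by
  intro t
  obtain ⟨n, hn⟩ : ∃ n, n = 1 + 1 + e + c + d + 1 := ⟨_, rfl⟩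
  have hp := doubleForkParent_spec 1 1 e c
  let p := doubleForkParent 1 1 e c
  -- `wt j` is the weight of the edge from `j` to its parent, so an edge between `x` and `u` has
  -- weight `wt (max x u)`.
  let wt : ℕ → ℝ := fun j => if 3 ≤ j ∧ j ≤ e + 2 then 2 else 1
  let π : ℕ → ℝ := fun x => if x = 1 ∨ 3 ≤ x ∧ x ≤ e + 2 then 4
    else if (c = 2 ∧ x = e + 3) ∨ (d = 2 ∧ x = e + 3 + c) then 2 else 1
  let s : (ℝ → ℝ) → ℕ → ℝ := fun g x =>
    ∑ u ∈ Finset.range n, if ParentLink p x u then g (wt (max x u)) else 0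
  have wt1 : ∀ j, ¬ (3 ≤ j ∧ j ≤ e + 2) → wt j = 1 := fun j hj => if_neg hj
  have wt2 : ∀ j, 3 ≤ j → j ≤ e + 2 → wt j = 2 := fun j hj hj' => if_pos ⟨hj, hj'⟩
  have hs : ∀ g x, x < n → s g x = _ := fun g x hx =>
    sum_doubleFork_neighbors hn one_pos he (by omega) (by omega) x hx fun u => g (wt (max x u))
  have s0 : ∀ g, s g 0 = g 1 := by
    intro g
    rw [hs g 0 (by omega), if_neg (by omega), if_pos (by omega), if_neg (by omega),
      if_neg (by omega), wt1 _ (by omega)]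
    ring
  have s1 : ∀ g, s g 1 = 2 * g 1 + g 2 := by
    intro g
    have := hp 1
    rw [hs g 1 (by omega), if_pos (by omega), if_pos (by omega), if_pos (by omega),
      if_neg (by omega), wt1 _ (by omega), wt1 _ (by omega), wt2 _ (by omega) (by omega)]
    ring
  have s2 : ∀ g, s g 2 = g 1 := by
    intro g
    have := hp 2
    rw [hs g 2 (by omega), if_pos (by omega), if_neg (by omega), if_neg (by omega),
      if_neg (by omega), wt1 _ (by omega)]
    ring
  have sm : ∀ g x, 3 ≤ x → x < e + 2 → s g x = 2 * g 2 := by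
    intro g x h1 h2
    have := hp x
    rw [hs g x (by omega), if_pos (by omega), if_pos (by omega), if_neg (by omega),
      if_neg (by omega), wt2 _ (by omega) (by omega), wt2 _ (by omega) (by omega)]
    ring
  have sw : ∀ g, s g (e + 2) = 2 * g 1 + g 2 := by
    intro g
    have := hp (e + 2)
    rw [hs g _ (by omega), if_pos (by omega), if_pos (by omega), if_neg (by omega),
      if_pos (by omega), wt2 _ (by omega) (by omega), wt1 _ (by omega), wt1 _ (by omega)]
    ring
  have sl : ∀ g, s g (e + 2 + c) = g 1 := by
    intro g
    have := hp (e + 2 + c)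
    rw [hs g _ (by omega), if_pos (by omega), if_neg (by omega), if_neg (by omega),
      if_neg (by omega), wt1 _ (by omega)]
    ring
  have sl' : ∀ g, s g (e + 2 + c + d) = g 1 := by
    intro g
    have := hp (e + 2 + c + d)
    rw [hs g _ (by omega), if_pos (by omega), if_neg (by omega), if_neg (by omega),
      if_neg (by omega), wt1 _ (by omega)]
    ring
  have sc : ∀ g, c = 2 → s g (e + 3) = 2 * g 1 := by
    intro g h
    have := hp (e + 3)
    rw [hs g _ (by omega), if_pos (by omega), if_pos (by omega), if_neg (by omega),
      if_neg (by omega), wt1 _ (by omega), wt1 _ (by omega)]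
    ring
  have sd : ∀ g, d = 2 → s g (e + 3 + c) = 2 * g 1 := by
    intro g h
    have := hp (e + 3 + c)
    rw [hs g _ (by omega), if_pos (by omega), if_pos (by omega), if_neg (by omega),
      if_neg (by omega), wt1 _ (by omega), wt1 _ (by omega)]
    ring
  have π0 : π 0 = 1 := by simp only [π]; rw [if_neg (by omega), if_neg (by omega)]
  have π1 : π 1 = 4 := if_pos (by omega)
  have π2 : π 2 = 1 := by simp only [π]; rw [if_neg (by omega), if_neg (by omega)]
  have πm : ∀ x, 3 ≤ x → x < e + 2 → π x = 4 := fun x h1 h2 => by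
    simp only [π]; rw [if_pos (by omega)]
  have πw : π (e + 2) = 4 := by simp only [π]; rw [if_pos (by omega)]
  have πl : π (e + 2 + c) = 1 := by simp only [π]; rw [if_neg (by omega), if_neg (by omega)]
  have πl' : π (e + 2 + c + d) = 1 := by simp only [π]; rw [if_neg (by omega), if_neg (by omega)]
  have πc : c = 2 → π (e + 3) = 2 := fun h =>
    (if_neg (by omega)).trans (if_pos (by omega))
  have πd : d = 2 → π (e + 3 + c) = 2 := fun h =>
    (if_neg (by omega)).trans (if_pos (by omega))
  have hπ : ∀ x, 0 < π x := fun x => by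
    simp only [π]
    split_ifs <;> norm_num
  have hsπ : ∀ x < n, s id x = π x := by
    intro x hx
    have hcases : x = 0 ∨ x = 1 ∨ x = 2 ∨ (3 ≤ x ∧ x < e + 2) ∨ x = e + 2 ∨ x = e + 2 + c ∨
        x = e + 2 + c + d ∨ (c = 2 ∧ x = e + 3) ∨ (d = 2 ∧ x = e + 3 + c) := by omega
    rcases hcases with rfl | rfl | rfl | ⟨h, h'⟩ | rfl | rfl | rfl | ⟨h, rfl⟩ | ⟨h, rfl⟩
    · rw [s0, π0, id]
    · rw [s1, π1]; norm_num
    · rw [s2, π2, id]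
    · rw [sm _ x h h', πm x h h']; norm_num
    · rw [sw, πw]; norm_num
    · rw [sl, πl, id]
    · rw [sl', πl', id]
    · rw [sc _ h, πc h]; norm_num
    · rw [sd _ h, πd h]; norm_num
  have log4 : Real.log 4 = 2 * Real.log 2 := by
    rw [show (4 : ℝ) = 2 ^ 2 by norm_num, Real.log_pow]
    norm_num
  have hsum1 := sum_doubleFork_short he hc hd (by omega : n = e + c + d + 3) π π0 π1 π2 πm πw πl πl'
    πc πd
  have hsum2 := sum_doubleFork_short he hc hd (by omega : n = e + c + d + 3)
    (fun x => π x * Real.log (π x)) (A := 0) (B := 8 * Real.log 2) (C := 8 * Real.log 2)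
    (D := 2 * Real.log 2) (by simp [π0]) (by simp only [π1, log4]; ring) (by simp [π2])
    (fun x h h' => by simp only [πm x h h', log4]; ring) (by simp only [πw, log4]; ring)
    (by simp [πl]) (by simp [πl']) (fun h => by simp only [πc h]) (fun h => by simp only [πd h])
  let η : ℝ → ℝ := fun z => z * Real.log z
  have η1 : η 1 = 0 := by simp [η]
  have η2 : η 2 = 2 * Real.log 2 := rfl
  have hsum3 := sum_doubleFork_short he hc hd (by omega : n = e + c + d + 3)
    (fun x => s η x) (A := 0) (B := 2 * Real.log 2) (C := 4 * Real.log 2)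
    (D := 0) (by simp only [s0, η1]) (by simp only [s1, η1, η2]; ring) (by simp only [s2, η1])
    (fun x h h' => by simp only [sm η x h h', η2]; ring) (by simp only [sw, η1, η2]; ring)
    (by simp only [sl, η1]) (by simp only [sl', η1]) (fun h => by simp only [sc η h, η1]; ring)
    (fun h => by simp only [sd η h, η1]; ring)
  let q : Fin n → Fin n → ℝ := fun x u => if ParentLink p x u then wt (max (x : ℕ) u) else 0
  have hwt : ∀ j, 0 < wt j := fun j => by
    simp only [wt]
    split_ifs <;> norm_num
  have hne : Nonempty (Fin n) := ⟨⟨0, by omega⟩⟩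
  have h := entropy_le_log_homCount (labelledTree n p) q (fun x => π x)
    (fun x u => by simp only [q]; split_ifs; exacts [(hwt _).le, le_rfl])
    (fun x u => by
      simp only [q, max_comm (x : ℕ) u]
      exact if_congr ⟨fun h => h.symm, fun h => h.symm⟩ rfl rfl)
    (fun x u h => by
      by_contra h'
      exact h (if_neg h'))
    (fun x => by
      rw [← hsπ x x.2]
      exact Fin.sum_univ_eq_sum_range
        (fun u => if ParentLink p x u then wt (max (x : ℕ) u) else 0) n)
    (fun x => hπ x) hT hk
  have hη : ∀ x : Fin n, ∑ u, q x u * Real.log (q x u) = s η x := by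
    intro x
    change _ = ∑ u ∈ Finset.range n, if ParentLink p x u then η (wt (max (x : ℕ) u)) else 0
    rw [← Fin.sum_univ_eq_sum_range
        (fun u => if ParentLink p x u then η (wt (max (x : ℕ) u)) else 0) n]
    refine Finset.sum_congr rfl fun u _ => ?_
    simp only [q, η]
    split_ifs <;> simp
  simp only [hη] at h
  rw [Finset.sum_sub_distrib, Fin.sum_univ_eq_sum_range π, Fin.sum_univ_eq_sum_range
    (fun x => π x * Real.log (π x)), Fin.sum_univ_eq_sum_range (fun x => s η x), hsum1, hsum2,
    hsum3] at h
  have hhom : homCount T (labelledTree n p) = homCount T (doubleFork 1 1 e c d) := by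
    subst hn
    rfl
  rw [hhom] at h
  have e1 : (4 * 1 + 2 * 4 + ((e : ℝ) - 1) * 4 + ((c : ℝ) + d - 2) * 2) = 4 * e + 2 * t := by
    simp only [t]
    ring
  rw [e1] at h
  have e2 : (4 * 0 + 2 * (8 * Real.log 2) + ((e : ℝ) - 1) * (8 * Real.log 2) +
      ((c : ℝ) + d - 2) * (2 * Real.log 2)) = (8 * e + 2 * t) * Real.log 2 := by
    simp only [t]
    ring
  have e3 : (4 * 0 + 2 * (2 * Real.log 2) + ((e : ℝ) - 1) * (4 * Real.log 2) +
      ((c : ℝ) + d - 2) * 0) = 4 * e * Real.log 2 := by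
    ring
  rw [e2, e3] at h
  have e4 : (8 * (e : ℝ) + 2 * t) * Real.log 2 - 4 * e * Real.log 2 =
      (4 * e + 2 * t) * Real.log 2 := by ring
  rw [e4] at h
  exact h

/-- The entropy bound amounts to `2 ^ i * M * 2 ^ (2 * t / M)` with `t = c + d + 2` and `i = k - 2`.
Linearising the last exponential gives `2 ^ i * (M + 2 * t * log 2)`, to be compared with `j * 2 ^
(i + 2) + 2`. -/
theorem homCount_path_le_doubleFork_short (hT : T.IsTree) (hV : 6 ≤ Fintype.card V)
    {n e c d : ℕ} (hn : n = e + c + d + 3) (he : 0 < e) (hc : c = 1 ∨ c = 2)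
    (hd : d = 1 ∨ d = 2) :
    homCount T (pathGraph n) ≤ homCount T (doubleFork 1 1 e c d) := by
  obtain ⟨i, hk⟩ : ∃ i, Fintype.card V = i + 2 + 1 := ⟨Fintype.card V - 3, by omega⟩
  have hmain := doubleFork_short_entropy hT hk he hc hd
  simp only at hmain
  obtain ⟨j, rfl⟩ : ∃ j, n = j + 2 := ⟨n - 2, by omega⟩
  have hup := homCount_path_le hT hk j
  obtain ⟨M, hM⟩ : ∃ M : ℝ, M = 4 * e + 2 * (c + d + 2) := ⟨_, rfl⟩
  have he' : (1 : ℝ) ≤ e := by exact_mod_cast he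
  have hlog2 := Real.log_pos (by norm_num : (1 : ℝ) < 2)
  have hlog2' := Real.log_two_gt_d9
  have hcd : (2 : ℝ) ≤ c + d ∧ (c : ℝ) + d ≤ 4 := by
    constructor
    · have : 2 ≤ c + d := by omega
      exact_mod_cast this
    · have : c + d ≤ 4 := by omega
      exact_mod_cast this
  have hM0 : 8 ≤ M := by rw [hM]; linarith
  rw [← hM, show (8 * (e : ℝ) + 2 * (c + d + 2)) = 2 * M - 2 * (c + d + 2) by rw [hM]; ring]
    at hmain
  push_cast at hmain
  obtain ⟨X, hX⟩ : ∃ X, X = homCount T (doubleFork 1 1 e c d) := ⟨_, rfl⟩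
  rw [← hX] at hmain ⊢
  have hpos : (0 : ℝ) < X := by
    rcases Nat.eq_zero_or_pos X with h0 | h0
    · rw [h0, Nat.cast_zero, Real.log_zero, mul_zero] at hmain
      have h1 : 2 * Real.log 2 < Real.log M := by
        have : (2 : ℝ) * Real.log 2 = Real.log (2 ^ 2) := by rw [Real.log_pow]; norm_num
        rw [this]
        exact Real.log_lt_log (by norm_num) (by linarith)
      have h2 := mul_lt_mul_of_pos_left h1 (by linarith : 0 < M)
      have h3 : 0 ≤ ((i : ℝ) + 2) * (M * Real.log 2) := by positivity
      have h4 : 0 ≤ (2 * ((c : ℝ) + d + 2)) * Real.log 2 := by positivity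
      linarith
    · exact_mod_cast h0
  have h1 : Real.log (M * 2 ^ i) + 2 * (c + d + 2) * Real.log 2 / M ≤ Real.log X := by
    refine le_of_mul_le_mul_left ?_ (by linarith : 0 < M)
    rw [mul_add, mul_div_cancel₀ _ (by linarith : M ≠ 0),
      Real.log_mul (by linarith) (by positivity), Real.log_pow]
    linarith
  have h2 : (M * 2 ^ i) * (1 + 2 * (c + d + 2) * Real.log 2 / M) ≤ X := by
    have h3 := Real.exp_le_exp.2 h1
    rw [Real.exp_log hpos, Real.exp_add, Real.exp_log (by positivity)] at h3
    refine le_trans (mul_le_mul_of_nonneg_left ?_ (by positivity)) h3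
    have := Real.add_one_le_exp (2 * (c + d + 2) * Real.log 2 / M : ℝ)
    linarith
  have h3 : (M * 2 ^ i) * (1 + 2 * (c + d + 2) * Real.log 2 / M) =
      2 ^ i * (M + 2 * (c + d + 2) * Real.log 2) := by
    field_simp
  rw [h3] at h2
  have hj : (j : ℝ) = e + c + d + 1 := by
    have : j = e + c + d + 1 := by omega
    rw [this]
    push_cast
    ring
  -- The slack `1 / 4` times `2 ^ i ≥ 8`, from at least six source vertices, pays for the final `+
  -- 2`. The tight case is `c + d = 4`, which needs `12 * log 2 ≥ 8.25`.
  have h4 : (4 * (j : ℝ) + 1 / 4) ≤ M + 2 * (c + d + 2) * Real.log 2 := by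
    have : ((c : ℝ) + d + 2) * 0.6931471803 ≤ (c + d + 2) * Real.log 2 :=
      mul_le_mul_of_nonneg_left hlog2'.le (by linarith)
    rw [hj, hM]
    norm_num at this
    linarith
  have h5 : (8 : ℝ) ≤ 2 ^ i := by
    calc (8 : ℝ) = 2 ^ 3 := by norm_num
      _ ≤ 2 ^ i := pow_le_pow_right₀ (by norm_num) (by omega)
  have h6 : (j : ℝ) * 2 ^ (i + 2) + 2 ≤ X := by
    have := mul_le_mul_of_nonneg_left h4 (by positivity : (0 : ℝ) ≤ 2 ^ i)
    rw [pow_add]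
    linarith
  have h7 : j * 2 ^ (i + 2) + 2 ≤ X := by exact_mod_cast h6
  omega

end DoubleForkWalk

/-! ### Double forks: shortening the legs -/

section DoubleForkBound

variable {V : Type*} (T : SimpleGraph V)

theorem homCount_doubleFork_swap [Finite V] (a b e c d : ℕ) (hb : 0 < b) (he : 0 < e) :
    homCount T (doubleFork a b e c d) ≤ homCount T (doubleFork a b e d c) := by
  obtain ⟨f, hf⟩ : ∃ f : ℕ → ℕ, ∀ y, (y ≤ a + b + e ∧ f y = y) ∨
      (a + b + e < y ∧ y ≤ a + b + e + c ∧ f y = y + d) ∨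
      (a + b + e + c < y ∧ f y = y - c) :=
    ⟨fun y => if y ≤ a + b + e then y else if y ≤ a + b + e + c then y + d else y - c,
      fun y => by dsimp only; split_ifs <;> omega⟩
  have hp := doubleForkParent_spec a b e c
  have hp' := doubleForkParent_spec a b e d
  refine homCount_labelledTree_le T f (fun i _ => ?_) (fun i _ j _ _ => ?_) fun j _ _ => ?_
  · have := hf i; omega
  · have := hf i; have := hf j; omega
  · have := hp j; have := hf j; have := hf (doubleForkParent a b e c j)
    have := hp' (f j); have := hp' (f (doubleForkParent a b e c j))
    unfold ParentLink
    omega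

theorem homCount_doubleFork_reverse [Finite V] (a b e c d : ℕ) (hb : 0 < b) (he : 0 < e)
    (hd : 0 < d) :
    homCount T (doubleFork a b e c d) ≤ homCount T (doubleFork c d e a b) := by
  obtain ⟨f, hf⟩ : ∃ f : ℕ → ℕ, ∀ y,
      (y ≤ a ∧ f y = c + d + e + (a - y)) ∨
      (a < y ∧ y ≤ a + b ∧ f y = c + d + e + y) ∨
      (a + b < y ∧ y < a + b + e ∧ f y = c + d + (a + b + e - y)) ∨
      (a + b + e ≤ y ∧ a + b < y ∧ y ≤ a + b + e + c ∧ f y = a + b + e + c - y) ∨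
      (a + b + e + c < y ∧ a + b < y ∧ f y = y - (a + b + e)) :=
    ⟨fun y => if y ≤ a then c + d + e + (a - y) else if y ≤ a + b then c + d + e + y else
      if y < a + b + e then c + d + (a + b + e - y) else
      if y ≤ a + b + e + c then a + b + e + c - y else y - (a + b + e),
      fun y => by dsimp only; split_ifs <;> omega⟩
  have hp := doubleForkParent_spec a b e c
  have hp' := doubleForkParent_spec c d e a
  refine homCount_labelledTree_le T f (fun i _ => ?_) (fun i _ j _ _ => ?_) fun j _ _ => ?_
  · have := hf i; omega
  · have := hf i; have := hf j; omega
  · obtain ⟨q, hq⟩ : ∃ q, q = doubleForkParent a b e c j := ⟨_, rfl⟩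
    have hpj := hp j
    rw [← hq] at hpj ⊢
    have h1 := hp' (f j)
    have h2 := hp' (f q)
    unfold ParentLink
    rcases hf j with h | h | h | h | h <;> rcases hf q with h' | h' | h' | h' | h' <;> omega

/-- Shift starting with `d = 0`, where the second branch vertex degenerates and the fork is a
tripod. -/
theorem homCount_tripod_le_doubleFork [Finite V] {a b e c d : ℕ} (ha : 0 < a)
    (he : 0 < e) (hd0 : 0 < d) (hd : Even d) :
    homCount T (tripod a b (e + d + c)) ≤ homCount T (doubleFork a b e c d) := by
  obtain ⟨t, rfl⟩ := even_iff_exists_two_mul.1 hd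
  have ht : 0 < t := by omega
  have h := homCount_doubleFork_le_shift T (a := a) (b := b) (c := c) ht ha he (Nat.zero_le 2)
  rw [zero_add] at h
  refine le_trans (le_of_eq ?_) h
  rw [← homCount_tripod_congr T (n := a + b + (e + 2 * t) + c + 0 + 1) (by omega)]
  refine congrArg _ (labelledTree_congr fun i hi => ?_)
  have := tripodParent_spec a b i
  have := doubleForkParent_spec a b (e + 2 * t) c i
  omega

variable {T}

theorem homCount_path_le_doubleFork_swap [Finite V] {a b e c d : ℕ} (hb : 0 < b) (he : 0 < e)
    (h : homCount T (pathGraph (a + b + e + d + c + 1)) ≤ homCount T (doubleFork a b e d c)) :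
    homCount T (pathGraph (a + b + e + c + d + 1)) ≤ homCount T (doubleFork a b e c d) := by
  have hn : homCount T (pathGraph (a + b + e + c + d + 1)) =
      homCount T (pathGraph (a + b + e + d + c + 1)) := by
    rw [show a + b + e + c + d + 1 = a + b + e + d + c + 1 by omega]
  exact (hn.le.trans h).trans (homCount_doubleFork_swap T a b e d c hb he)

theorem homCount_path_le_doubleFork_reverse [Finite V] {a b e c d : ℕ} (hb : 0 < b) (he : 0 < e)
    (hd : 0 < d)
    (h : homCount T (pathGraph (c + d + e + a + b + 1)) ≤ homCount T (doubleFork c d e a b)) :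
    homCount T (pathGraph (a + b + e + c + d + 1)) ≤ homCount T (doubleFork a b e c d) := by
  have hn : homCount T (pathGraph (a + b + e + c + d + 1)) =
      homCount T (pathGraph (c + d + e + a + b + 1)) := by
    rw [show a + b + e + c + d + 1 = c + d + e + a + b + 1 by omega]
  exact (hn.le.trans h).trans (homCount_doubleFork_reverse T c d e a b hd he hb)

theorem homCount_path_le_doubleFork_of_short [Finite V] {a b c : ℕ} (ha : 0 < a)
    (h : ∀ e d, 0 < e → 0 < d → d ≤ 2 →
      homCount T (pathGraph (a + b + e + c + d + 1)) ≤ homCount T (doubleFork a b e c d))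
    {e d : ℕ} (he : 0 < e) (hd : 0 < d) :
    homCount T (pathGraph (a + b + e + c + d + 1)) ≤ homCount T (doubleFork a b e c d) := by
  rcases le_or_gt d 2 with hd2 | hd2
  · exact h e d he hd hd2
  -- `d'` is `1` or `2`, with the parity of `d`; the surplus goes into the connecting path.
  obtain ⟨d', t, hd', hd2', ht, rfl⟩ : ∃ d' t, 0 < d' ∧ d' ≤ 2 ∧ 0 < t ∧ d = d' + 2 * t :=
    ⟨2 - d % 2, (d - 1) / 2, by omega, by omega, by omega, by omega⟩
  have hn : homCount T (pathGraph (a + b + e + c + (d' + 2 * t) + 1)) =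
      homCount T (pathGraph (a + b + (e + 2 * t) + c + d' + 1)) := by
    rw [show a + b + e + c + (d' + 2 * t) + 1 = a + b + (e + 2 * t) + c + d' + 1 by omega]
  exact (hn.le.trans (h (e + 2 * t) d' (by omega) hd' hd2')).trans
    (homCount_doubleFork_le_shift T ht ha he hd2')

/-- Two legs of length one at an end lead to the explicit walk. Otherwise each end has a leg of
length two: one is absorbed by a shift, and the other is an even leg of the resulting tripod. -/
theorem homCount_path_le_doubleFork_of_le_two [Fintype V] (hT : T.IsTree)
    (hV : 6 ≤ Fintype.card V) {a b e c d : ℕ} (ha : 0 < a) (hb : 0 < b) (he : 0 < e) (hc : 0 < c)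
    (hd : 0 < d) (ha2 : a ≤ 2) (hb2 : b ≤ 2) (hc2 : c ≤ 2) (hd2 : d ≤ 2) :
    homCount T (pathGraph (a + b + e + c + d + 1)) ≤ homCount T (doubleFork a b e c d) := by
  have key : ∀ {c}, 0 < c → (Even a ∨ Even b) →
      homCount T (pathGraph (a + b + e + c + 2 + 1)) ≤ homCount T (doubleFork a b e c 2) := by
    intro c hc hab
    have h1 : homCount T (tripod a b (e + 2 + c)) ≤ homCount T (doubleFork a b e c 2) :=
      homCount_tripod_le_doubleFork T ha he (Nat.succ_pos 1) even_two
    have h2 : homCount T (pathGraph (a + b + e + c + 2 + 1)) ≤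
        homCount T (tripod a b (e + 2 + c)) :=
      homCount_path_le_tripod hT (by omega) ha hb (by omega) (by tauto)
    exact h2.trans h1
  by_cases hab : a = 1 ∧ b = 1
  · obtain ⟨rfl, rfl⟩ := hab
    have hn : 1 + 1 + e + c + d + 1 = e + c + d + 3 := by omega
    exact homCount_path_le_doubleFork_short hT hV hn he (by omega) (by omega)
  by_cases hcd : c = 1 ∧ d = 1
  · have h1 : homCount T (pathGraph (c + d + e + a + b + 1)) ≤
        homCount T (doubleFork c d e a b) := by
      rw [hcd.1, hcd.2]
      exact homCount_path_le_doubleFork_short hT hV (by omega) he (by omega) (by omega)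
    exact homCount_path_le_doubleFork_reverse hb he hd h1
  have hab' : Even a ∨ Even b := by
    rw [Nat.even_iff, Nat.even_iff]
    omega
  obtain rfl | rfl : d = 2 ∨ c = 2 := by omega
  · exact key hc hab'
  · exact homCount_path_le_doubleFork_swap hb he (key hd hab')

/-- The bound `2` is lifted from one leg after another, swaps and the reversal bringing each leg
into the fourth place. -/
theorem homCount_path_le_doubleFork [Fintype V] (hT : T.IsTree) (hV : 6 ≤ Fintype.card V)
    {a b e c d : ℕ} (ha : 0 < a) (hb : 0 < b) (he : 0 < e) (hc : 0 < c) (hd : 0 < d) :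
    homCount T (pathGraph (a + b + e + c + d + 1)) ≤ homCount T (doubleFork a b e c d) := by
  have h1 : ∀ {a b c e d}, 0 < a → 0 < b → 0 < e → 0 < c → 0 < d → a ≤ 2 → b ≤ 2 → c ≤ 2 →
      homCount T (pathGraph (a + b + e + c + d + 1)) ≤ homCount T (doubleFork a b e c d) :=
    fun ha hb he hc hd ha2 hb2 hc2 => homCount_path_le_doubleFork_of_short ha
      (fun _ _ he hd hd2 => homCount_path_le_doubleFork_of_le_two hT hV ha hb he hc hd ha2 hb2
        hc2 hd2) he hd
  have h2 : ∀ {a b c e d}, 0 < a → 0 < b → 0 < e → 0 < c → 0 < d → a ≤ 2 → b ≤ 2 →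
      homCount T (pathGraph (a + b + e + c + d + 1)) ≤ homCount T (doubleFork a b e c d) :=
    fun ha hb he hc hd ha2 hb2 => homCount_path_le_doubleFork_of_short ha
      (fun _ _ he hd hd2 => homCount_path_le_doubleFork_swap hb he
        (h1 ha hb he hd hc ha2 hb2 hd2)) he hd
  have h3 : ∀ {a b c e d}, 0 < a → 0 < b → 0 < e → 0 < c → 0 < d → c ≤ 2 →
      homCount T (pathGraph (a + b + e + c + d + 1)) ≤ homCount T (doubleFork a b e c d) :=
    fun ha hb he hc hd hc2 => homCount_path_le_doubleFork_of_short ha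
      (fun _ _ he hd hd2 => homCount_path_le_doubleFork_reverse hb he hd
        (h2 hc hd he ha hb hc2 hd2)) he hd
  exact homCount_path_le_doubleFork_of_short ha
    (fun _ _ he hd hd2 => homCount_path_le_doubleFork_swap hb he (h3 ha hb he hd hc hd2)) he hd

end DoubleForkBound

/-! ### Classification -/

theorem starlikeY_not_adj_none_none (a b c : ℕ) : ¬ (starlikeY a b c).Adj none none :=
  SimpleGraph.irrefl _

theorem starlikeY_adj_none_some {a b c : ℕ} (y : Σ i : Fin 3, Fin (![a, b, c] i)) :
    (starlikeY a b c).Adj none (some y) ↔ (y.2 : ℕ) = 0 := by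
  simp [starlikeY]

theorem starlikeY_adj_some_some {a b c : ℕ} (x y : Σ i : Fin 3, Fin (![a, b, c] i)) :
    (starlikeY a b c).Adj (some x) (some y) ↔
      x.1 = y.1 ∧ ((y.2 : ℕ) = x.2 + 1 ∨ (x.2 : ℕ) = y.2 + 1) := by
  rw [starlikeY, SimpleGraph.fromRel_adj]
  constructor
  · rintro ⟨-, ⟨h, h'⟩ | ⟨h, h'⟩⟩
    exacts [⟨h, Or.inl h'⟩, ⟨h.symm, Or.inr h'⟩]
  · rintro ⟨h, h'⟩
    refine ⟨?_, h'.imp (fun h' => ⟨h, h'⟩) fun h' => ⟨h.symm, h'⟩⟩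
    rintro ⟨⟩
    omega

theorem nonempty_tripod_iso_starlikeY {c n : ℕ} (hn : n = c + 3) :
    Nonempty (labelledTree n (tripodParent 1 1) ≃g starlikeY 1 1 c) := by
  obtain ⟨f, hnone, hsome⟩ : ∃ f : Option (Σ i : Fin 3, Fin (![1, 1, c] i)) → ℕ, f none = 1 ∧
      ∀ y, ((y.1 : ℕ) = 0 ∧ (y.2 : ℕ) = 0 ∧ f (some y) = 0) ∨
        ((y.1 : ℕ) = 1 ∧ (y.2 : ℕ) = 0 ∧ f (some y) = 2) ∨
        ((y.1 : ℕ) = 2 ∧ (y.2 : ℕ) < c ∧ f (some y) = 3 + y.2) := by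
    refine ⟨fun x => x.elim 1 fun y => (![0, 2, 3 + y.2.val] : Fin 3 → ℕ) y.1, rfl, ?_⟩
    rintro ⟨i, j⟩
    have hj := j.2
    fin_cases i
    · exact Or.inl ⟨rfl, Nat.lt_one_iff.1 hj, rfl⟩
    · exact Or.inr (Or.inl ⟨rfl, Nat.lt_one_iff.1 hj, rfl⟩)
    · exact Or.inr (Or.inr ⟨rfl, hj, rfl⟩)
  have hlt : ∀ x, f x < n := by
    rintro (_ | y)
    · omega
    · have := hsome y; omega
  have hinj : Function.Injective f := by
    rintro (_ | ⟨i, j⟩) (_ | ⟨i', j'⟩) h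
    · rfl
    · have := hsome ⟨i', j'⟩; omega
    · have := hsome ⟨i, j⟩; omega
    · have h1 := hsome ⟨i, j⟩
      have h2 := hsome ⟨i', j'⟩
      dsimp only at h1 h2
      obtain rfl : i = i' := Fin.ext (by omega)
      obtain rfl : j = j' := Fin.ext (by omega)
      rfl
  have hp := tripodParent_spec 1 1
  have hadj_none : ∀ y, (starlikeY 1 1 c).Adj none (some y) ↔
      ParentLink (tripodParent 1 1) (f none) (f (some y)) := fun y => by
    rw [starlikeY_adj_none_some, hnone]
    have := hsome y
    have := hp 1
    have := hp (f (some y))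
    unfold ParentLink
    omega
  have hadj : ∀ x y, (starlikeY 1 1 c).Adj x y ↔ ParentLink (tripodParent 1 1) (f x) (f y) := by
    rintro (_ | x) (_ | y)
    · refine iff_of_false (starlikeY_not_adj_none_none _ _ _) ?_
      unfold ParentLink
      omega
    · exact hadj_none y
    · exact (SimpleGraph.adj_comm _ _ _).trans ((hadj_none x).trans ⟨fun h => h.symm,
        fun h => h.symm⟩)
    · rw [starlikeY_adj_some_some, Fin.ext_iff]
      have := hsome x
      have := hsome y
      have := hp (f (some x))
      have := hp (f (some y))
      unfold ParentLink
      omega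
  have hcard : Fintype.card (Option (Σ i : Fin 3, Fin (![1, 1, c] i))) = n := by
    simp only [Fintype.card_option, Fintype.card_sigma, Fin.sum_univ_three, Fintype.card_fin]
    change 1 + 1 + c + 1 = n
    omega
  let F : Option (Σ i : Fin 3, Fin (![1, 1, c] i)) → Fin n := fun x => ⟨f x, hlt x⟩
  have hF : Function.Bijective F := by
    rw [Fintype.bijective_iff_injective_and_card, hcard, Fintype.card_fin]
    exact ⟨fun x y h => hinj (congrArg Fin.val h), rfl⟩
  exact ⟨SimpleGraph.Iso.symm ⟨Equiv.ofBijective F hF, fun {x y} => (hadj x y).symm⟩⟩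

theorem nonempty_iso_starlikeY {W : Type*} {G : SimpleGraph W} {a b c n : ℕ}
    (hn : n = a + b + c + 1) (e : G ≃g labelledTree n (tripodParent a b))
    (h : a = 1 ∧ b = 1 ∨ b = 1 ∧ c = 1 ∨ a = 1 ∧ c = 1) :
    Nonempty (G ≃g starlikeY 1 1 (n - 3)) := by
  rcases h with ⟨rfl, rfl⟩ | ⟨rfl, rfl⟩ | ⟨rfl, rfl⟩
  · obtain ⟨f⟩ := nonempty_tripod_iso_starlikeY (c := n - 3) (n := n) (by omega)
    exact ⟨e.trans f⟩
  · obtain ⟨f⟩ := nonempty_tripod_iso_starlikeY (c := n - 3) (n := n) (by omega)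
    obtain ⟨g, -⟩ := exists_iso_tripod_swap_left a 1 1 hn
    obtain ⟨g', -⟩ := exists_iso_tripod_swap_right 1 a 1 (n := n) (by omega)
    exact ⟨((e.trans g).trans g').trans f⟩
  · obtain ⟨f⟩ := nonempty_tripod_iso_starlikeY (c := n - 3) (n := n) (by omega)
    obtain ⟨g, -⟩ := exists_iso_tripod_swap_right 1 b 1 hn
    exact ⟨(e.trans g).trans f⟩

theorem mainTheorem4 {V W : Type*} [Fintype V] [Fintype W] (n : ℕ)
    (Tm : SimpleGraph V) (Tn : SimpleGraph W)
    (hTm : Tm.IsTree) (hTn : Tn.IsTree) (hn : Fintype.card W = n)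
    (h : homCount Tm Tn < homCount Tm (SimpleGraph.pathGraph n)) :
    Nonempty (Tn ≃g starlikeY 1 1 (n - 3)) ∧ Even n := by
  classical
  obtain ⟨m, rfl⟩ : ∃ m, n = m + 1 :=
    ⟨n - 1, by have := Fintype.card_pos_iff.2 hTn.connected.nonempty; omega⟩
  have hbr : ¬ ((∃ x, 4 ≤ valency Tn x) ∨
      ∃ s : Finset W, s.card = 3 ∧ ∀ x ∈ s, 3 ≤ valency Tn x) := fun hbr => by
    have := homCount_path_le_of_branching hTn hbr hTm
    rw [hn] at this
    omega
  push Not at hbr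
  obtain ⟨h4, h3⟩ := hbr
  obtain ⟨l, hl⟩ : ∃ l, valency Tn l ≤ 1 := by
    rcases subsingleton_or_nontrivial W with hW | hW
    · obtain ⟨x⟩ := hTn.connected.nonempty
      exact ⟨x, valency_le_one_of_unique (w := x) fun u _ => Subsingleton.elim _ _⟩
    · obtain ⟨l, hl⟩ := exists_isTree_leaf hTn
      exact ⟨l, hl.le⟩
  by_cases hx : ∀ u, valency Tn u ≤ 2
  · obtain ⟨e, -⟩ := exists_iso_path hTn hn hx l hl
    rw [labelledTree_pred] at e
    exact absurd (homCount_congr SimpleGraph.Iso.refl e) h.ne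
  push Not at hx
  obtain ⟨x, hx⟩ := hx
  have hx3 : valency Tn x = 3 := by have := h4 x; omega
  by_cases hy : ∀ u, u ≠ x → valency Tn u ≤ 2
  · obtain ⟨a, b, c, ha, hb, hc, hm, e, -⟩ := exists_iso_tripod hTn hn x hx3 hy l hl
    have hcount : homCount Tm Tn = homCount Tm (tripod a b c) := by
      rw [← homCount_tripod_congr Tm (by omega : m + 1 = a + b + c + 1)]
      exact homCount_congr SimpleGraph.Iso.refl e
    have hshape := mt (homCount_path_le_tripod hTm (by omega : m + 1 = a + b + c + 1) ha hb hc)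
      (by rw [← hcount]; exact h.not_ge)
    -- All three legs are odd and no two are at least three, so two equal `1`, and the number of
    -- vertices, a sum of three odd numbers plus one, is even.
    simp only [Nat.even_iff, not_or] at hshape
    exact ⟨nonempty_iso_starlikeY (c := c) (by omega) e (by omega), by rw [Nat.even_iff]; omega⟩
  push Not at hy
  obtain ⟨y, hyx, hy⟩ := hy
  have hy3 : valency Tn y = 3 := by have := h4 y; omega
  have hother : ∀ u, u ≠ x → u ≠ y → valency Tn u ≤ 2 := fun u hux huy => by
    by_contra hu
    obtain ⟨z, hz, hz3⟩ := h3 {x, y, u} (Finset.card_eq_three.2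
      ⟨x, y, u, hyx.symm, hux.symm, huy.symm, rfl⟩)
    simp only [Finset.mem_insert, Finset.mem_singleton] at hz
    rcases hz with rfl | rfl | rfl <;> omega
  exfalso
  rcases le_or_gt (Fintype.card V) 6 with hV | hV
  · have := homCount_path_le_of_two_branching hTn hyx.symm hx3 hy3 hTm hV
    rw [hn] at this
    omega
  · obtain ⟨a, b, e, c, d, ha, hb, he, hc, hd, rfl, f, -⟩ :=
      exists_iso_doubleFork hTn hn x y hyx.symm hx3 hy3 hother l hl
    have := homCount_path_le_doubleFork hTm hV.le ha hb he hc hd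
    have hcount : homCount Tm Tn = homCount Tm (doubleFork a b e c d) :=
      homCount_congr SimpleGraph.Iso.refl f
    omega
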